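/- Let $k$ be a positive even integer, let $(a_n)_{n\ge 1}$ be complex numbers, and write $e(z)=e^{2\pi i z}$. Suppose that $$f(z)=\sum_{n=1}^\infty a_n e(nz)$$ converges and is holomorphic in the upper half-plane $\Im z>0$. Suppose that for some real $c$ the Dirichlet series $$L_f(s)=\sum_{n=1}^\infty \frac{a_n}{n^s}$$ converges for $\Re s>c$ and satisfies there $$L_f(s)=\left(1-\frac{a_2}{2^s}+\frac{2^{k-1}}{2^{2s}}\right)^{-1}\left(1-\frac{a_3}{3^s}+\frac{3^{k-1}}{3^{2s}}\right)^{-1}\sum_{(n,6)=1}\frac{a_n}{n^s},$$ the last series being convergent as well. Suppose finally that $$\Lambda(s)=\left(\frac{\sqrt{13}}{2\pi}\right)^s\Gamma(s)L_f(s)\qquad(\Re s>c)$$ extends to an entire function $\Lambda$ which is bounded in every vertical strip $\sigma_1\le\Re s\le\sigma_2$ and satisfies the functional equation $$\Lambda(s)=\epsilon\,\Lambda(k-s)\qquad(s\in\mathbb{C}),\qquad \epsilon\in\{1,-1\}.$$ Then $f$ is a cusp form of weight $k$ for $\Gamma_0(13)=\left\{\begin{pmatrix}\alpha&\beta\\\gamma&\delta\end{pmatrix}\in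 \mathrm{SL}_2(\mathbb{Z}): 13\mid \gamma\right\}$, that is, $f\in S_k(\Gamma_0(13))$. -/

import Mathlib

open scoped UpperHalfPlane Manifold MatrixGroups

/-- The Dirichlet series `∑_{n ≥ 1} a n / n ^ s` converges (as the limit of its partial sums,
not necessarily absolutely) and its sum is `l`. The value `a 0` plays no role. -/
def HasDirichletSum (a : ℕ → ℂ) (s l : ℂ) : Prop :=
  Filter.Tendsto (fun N : ℕ => ∑ n ∈ Finset.Icc 1 N, a n / (n : ℂ) ^ s) Filter.atTop (nhds l)

/-- The function `Λ` is bounded in every fixed vertical strip `σ₁ ≤ Re s ≤ σ₂`. -/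
def BoundedInVerticalStrips (Λ : ℂ → ℂ) : Prop :=
  ∀ σ₁ σ₂ : ℝ, ∃ C : ℝ, ∀ s : ℂ, σ₁ ≤ s.re → s.re ≤ σ₂ → ‖Λ s‖ ≤ C

/-! Write k = 2m and let `|` be the slash action of weight k. The functional equation gives only
`f|W = ±f` for the Fricke matrix W (`fricke_of_functional_equation`), and the Euler factors give
only that f is an eigenfunction of the Hecke operators T₂ and T₃ (`hecke_coefficients`,
`normSlash_hecke`). Invariance under Γ₀(13) has to be extracted from these facts and periodicity.

Conjugating T₂ by W swaps two of its three terms and moves the third; comparison gives invariance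
under matrices with lower row (±13, 2). For T₃ two terms move, so only a sum is controlled. The
obstruction is `h = f - f|A`, with A = (-4 -1; 13 3) elliptic of order 3. Combining all the
symmetries yields four relations for h (`order_three_defect_relations`). They imply that h is fixed
by two commuting hyperbolic matrices, whose common fixed points are the real roots of Q = 52z² + 26z
+ 3, and whose eigenvalue ratios are multiplicatively independent (`irrational_log_ratio`). The
dilations they generate are dense, so hQᵐ is a constant C. If C ≠ 0, the relation `h + h|A + h|A² =
0` becomes a polynomial identity that fails at a root of Q; hence h = 0
(`eq_zero_of_order_three_relations`).

Now f is invariant under a matrix (x *; 13 *) for every x prime to 13, and a Euclidean descent on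
the lower left entry reaches all of Γ₀(13) (`gamma0_thirteen_invariant`). There are two cusps,
exchanged by W, so vanishing at ∞ suffices for cuspidality. -/

noncomputable section

/-! ### The slash operator for real matrices -/

open UpperHalfPlane ModularForm

/-- The real matrix with rows `(a, b)` and `(c, d)`, as an element of `GL (Fin 2) ℝ`
(the identity if it is singular). -/
def realGL (a b c d : ℝ) : GL (Fin 2) ℝ :=
  if h : a * d - b * c ≠ 0 then
    Matrix.GeneralLinearGroup.mkOfDetNeZero !![a, b; c, d] (by rwa [Matrix.det_fin_two_of])
  else 1

lemma coe_realGL {a b c d : ℝ} (h : 0 < a * d - b * c) :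
    (realGL a b c d : Matrix (Fin 2) (Fin 2) ℝ) = !![a, b; c, d] := by
  rw [realGL, dif_pos h.ne']
  rfl

lemma det_realGL {a b c d : ℝ} (h : 0 < a * d - b * c) :
    (realGL a b c d).det.val = a * d - b * c := by
  rw [Matrix.GeneralLinearGroup.val_det_apply, coe_realGL h, Matrix.det_fin_two_of]

lemma realGL_mul {a b c d a' b' c' d' : ℝ} (h : 0 < a * d - b * c) (h' : 0 < a' * d' - b' * c') :
    realGL a b c d * realGL a' b' c' d' =
      realGL (a * a' + b * c') (a * b' + b * d') (c * a' + d * c') (c * b' + d * d') := by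
  apply Units.ext
  rw [Units.val_mul, coe_realGL h, coe_realGL h', coe_realGL, Matrix.mul_fin_two]
  have := mul_pos h h'
  linarith

lemma coe_realGL_smul {a b c d : ℝ} (h : 0 < a * d - b * c) (z : ℍ) :
    ((realGL a b c d • z : ℍ) : ℂ) = (a * z + b) / (c * z + d) := by
  rw [coe_smul_of_det_pos (by rwa [det_realGL h])]
  simp [num, denom, coe_realGL h]

lemma linear_ne_zero_of_det_pos {a b c d : ℝ} (h : 0 < a * d - b * c) (z : ℍ) :
    (c * z + d : ℂ) ≠ 0 := by
  have := denom_ne_zero (realGL a b c d) z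
  simpa [denom, coe_realGL h] using this

/-- The slash operator of weight `2 m`, normalised so that scalar matrices act trivially. -/
def normSlash (m : ℕ) (f : ℍ → ℂ) (a b c d : ℝ) : ℍ → ℂ := fun z =>
  (((a * d - b * c : ℝ) : ℂ) / (c * z + d) ^ 2) ^ m * f (realGL a b c d • z)

variable {m : ℕ} {f g : ℍ → ℂ}

lemma normSlash_comp {a b c d a' b' c' d' : ℝ}
    (h : 0 < a * d - b * c) (h' : 0 < a' * d' - b' * c') :
    normSlash m (normSlash m f a b c d) a' b' c' d' =
      normSlash m f (a * a' + b * c') (a * b' + b * d') (c * a' + d * c') (c * b' + d * d') := by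
  funext z
  simp only [normSlash]
  rw [← mul_smul, realGL_mul h h', coe_realGL_smul h', ← mul_assoc, ← mul_pow]
  congr 2
  have h1 := linear_ne_zero_of_det_pos h' z
  have h2 := linear_ne_zero_of_det_pos h (realGL a' b' c' d' • z)
  rw [coe_realGL_smul h'] at h2
  have h3 : (c * ((a' * z + b') / (c' * z + d')) + d : ℂ) * (c' * z + d') =
      ((c * a' + d * c' : ℝ) * z + (c * b' + d * d' : ℝ)) := by
    push_cast
    rw [add_mul, mul_assoc, div_mul_cancel₀ _ h1]
    ring
  rw [← h3]
  push_cast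
  field_simp
  ring

lemma normSlash_scale {a b c d t : ℝ} (ht : t ≠ 0) (h : 0 < a * d - b * c) :
    normSlash m f (t * a) (t * b) (t * c) (t * d) = normSlash m f a b c d := by
  have h' : 0 < t * a * (t * d) - t * b * (t * c) := by
    have : t * a * (t * d) - t * b * (t * c) = t ^ 2 * (a * d - b * c) := by ring
    rw [this]; positivity
  funext z
  have h1 := linear_ne_zero_of_det_pos h z
  have ht' : (t : ℂ) ≠ 0 := by exact_mod_cast ht
  have h2 : realGL (t * a) (t * b) (t * c) (t * d) • z = realGL a b c d • z := by
    apply UpperHalfPlane.ext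
    rw [coe_realGL_smul h, coe_realGL_smul h']
    push_cast
    rw [show (t * a * z + t * b : ℂ) = t * (a * z + b) by ring,
      show (t * c * z + t * d : ℂ) = t * (c * z + d) by ring, mul_div_mul_left _ _ ht']
  simp only [normSlash, h2]
  congr 2
  push_cast
  rw [show (t * c * z + t * d : ℂ) = t * (c * z + d) by ring]
  field_simp

lemma normSlash_one : normSlash m f 1 0 0 1 = f := by
  funext z
  have h : (0 : ℝ) < 1 * 1 - 0 * 0 := by norm_num
  have : realGL 1 0 0 1 • z = z := by
    apply UpperHalfPlane.ext
    rw [coe_realGL_smul h]; simp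
  simp [normSlash, this]

lemma normSlash_scalar {t : ℝ} (ht : t ≠ 0) : normSlash m f t 0 0 t = f := by
  conv_rhs => rw [← normSlash_one (m := m) (f := f), ← normSlash_scale ht (by norm_num)]
  simp

lemma normSlash_add (a b c d : ℝ) :
    normSlash m (f + g) a b c d = normSlash m f a b c d + normSlash m g a b c d := by
  funext z; simp [normSlash, mul_add]

lemma normSlash_sub (a b c d : ℝ) :
    normSlash m (f - g) a b c d = normSlash m f a b c d - normSlash m g a b c d := by
  funext z; simp [normSlash, mul_sub]

lemma normSlash_neg (a b c d : ℝ) :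
    normSlash m (-f) a b c d = -normSlash m f a b c d := by
  funext z; simp [normSlash]

lemma normSlash_smul (t : ℂ) (a b c d : ℝ) :
    normSlash m (t • f) a b c d = t • normSlash m f a b c d := by
  funext z; simp [normSlash]; ring

lemma normSlash_zero (a b c d : ℝ) : normSlash m (0 : ℍ → ℂ) a b c d = 0 := by
  funext z; simp [normSlash]

/-- The normalised slash operator by a matrix of positive determinant is injective. -/
lemma normSlash_injective {a b c d : ℝ} (h : 0 < a * d - b * c)
    (hfg : normSlash m f a b c d = normSlash m g a b c d) : f = g := by
  have h' : 0 < d * a - -b * -c := by linarith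
  have key : normSlash m (normSlash m f a b c d) d (-b) (-c) a =
      normSlash m (normSlash m g a b c d) d (-b) (-c) a := by rw [hfg]
  rw [normSlash_comp h h', normSlash_comp h h',
    show a * d + b * -c = a * d - b * c by ring, show a * -b + b * a = 0 by ring,
    show c * d + d * -c = 0 by ring, show c * -b + d * a = a * d - b * c by ring,
    normSlash_scalar h.ne', normSlash_scalar h.ne'] at key
  exact key

lemma normSlash_inv {a b c d : ℝ} (h : 0 < a * d - b * c) (hf : normSlash m f a b c d = f) :
    normSlash m f d (-b) (-c) a = f := by
  have h' : 0 < d * a - -b * -c := by linarith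
  conv_lhs => rw [← hf]
  rw [normSlash_comp h h',
    show a * d + b * -c = a * d - b * c by ring, show a * -b + b * a = 0 by ring,
    show c * d + d * -c = 0 by ring, show c * -b + d * a = a * d - b * c by ring,
    normSlash_scalar h.ne']

lemma normSlash_eq_slash {γ : GL (Fin 2) ℝ} (h : γ.det.val = 1) :
    f ∣[(2 * m : ℤ)] γ = normSlash m f (γ 0 0) (γ 0 1) (γ 1 0) (γ 1 1) := by
  have hd : γ 0 0 * γ 1 1 - γ 0 1 * γ 1 0 = 1 := by
    rw [← h, Matrix.GeneralLinearGroup.val_det_apply, Matrix.det_fin_two]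
  have hγ : realGL (γ 0 0) (γ 0 1) (γ 1 0) (γ 1 1) = γ := by
    apply Units.ext
    rw [coe_realGL (by rw [hd]; norm_num)]
    exact (Matrix.eta_fin_two _).symm
  funext z
  rw [slash_def, normSlash, hγ, hd]
  simp only [σ, h, zero_lt_one, if_true, denom]
  simp only [abs_one, Complex.ofReal_one, one_zpow, mul_one, ContinuousAlgEquiv.refl_apply,
    one_div]
  rw [mul_comm, zpow_neg, inv_pow, ← pow_mul]
  norm_cast

lemma MDifferentiable.normSlash (hf : MDifferentiable 𝓘(ℂ) 𝓘(ℂ) f) {a b c d : ℝ}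
    (h : 0 < a * d - b * c) : MDifferentiable 𝓘(ℂ) 𝓘(ℂ) (normSlash m f a b c d) := by
  have h1 : MDifferentiable 𝓘(ℂ) 𝓘(ℂ) (fun z : ℍ => f (realGL a b c d • z)) :=
    hf.comp (mdifferentiable_smul (by rwa [det_realGL h]))
  have h2 := mdifferentiable_denom_zpow (realGL a b c d) (-(2 * m))
  have h3 : _root_.normSlash m f a b c d = (((a * d - b * c : ℝ) : ℂ) ^ m) •
      ((fun z : ℍ => f (realGL a b c d • z)) *
        fun z : ℍ => denom (realGL a b c d) z ^ (-(2 * m : ℤ))) := by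
    funext z
    simp only [_root_.normSlash, denom, coe_realGL h, Pi.smul_apply, Pi.mul_apply, smul_eq_mul,
      div_pow, ← pow_mul, zpow_neg, Matrix.of_apply, Matrix.cons_val', Matrix.cons_val_zero,
      Matrix.cons_val_one, Matrix.cons_val_fin_one]
    norm_cast
    ring
  rw [h3]
  exact (h1.mul h2).const_smul _

end

/-! ### Relations in the matrix action forced by W, T₂ and T₃ -/

noncomputable section

open UpperHalfPlane ModularForm

section Relations

variable {m : ℕ} {f : ℍ → ℂ}

lemma normSlash_comp_eq (t : ℝ) {a b c d a' b' c' d' A B C D : ℝ}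
    (h : 0 < a * d - b * c := by norm_num) (h' : 0 < a' * d' - b' * c' := by norm_num)
    (hD : 0 < A * D - B * C := by norm_num) (ht : t ≠ 0 := by norm_num)
    (hA : a * a' + b * c' = t * A := by norm_num) (hB : a * b' + b * d' = t * B := by norm_num)
    (hC : c * a' + d * c' = t * C := by norm_num) (hE : c * b' + d * d' = t * D := by norm_num) :
    normSlash m (normSlash m f a b c d) a' b' c' d' = normSlash m f A B C D := by
  rw [normSlash_comp h h', hA, hB, hC, hE, normSlash_scale ht hD]

lemma normSlash_comp_scalar (t : ℝ) {a b c d a' b' c' d' : ℝ}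
    (h : 0 < a * d - b * c := by norm_num) (h' : 0 < a' * d' - b' * c' := by norm_num)
    (ht : t ≠ 0 := by norm_num)
    (hA : a * a' + b * c' = t := by norm_num) (hB : a * b' + b * d' = 0 := by norm_num)
    (hC : c * a' + d * c' = 0 := by norm_num) (hE : c * b' + d * d' = t := by norm_num) :
    normSlash m (normSlash m f a b c d) a' b' c' d' = f := by
  rw [normSlash_comp h h', hA, hB, hC, hE, normSlash_scalar ht]

/-- If `f` is invariant under the first factor, the product acts as the second factor. -/
lemma normSlash_of_invariant (t : ℝ) {a b c d a' b' c' d' A B C D : ℝ}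
    (hf : normSlash m f a b c d = f)
    (h : 0 < a * d - b * c := by norm_num) (h' : 0 < a' * d' - b' * c' := by norm_num)
    (hD : 0 < A * D - B * C := by norm_num) (ht : t ≠ 0 := by norm_num)
    (hA : a * a' + b * c' = t * A := by norm_num) (hB : a * b' + b * d' = t * B := by norm_num)
    (hC : c * a' + d * c' = t * C := by norm_num) (hE : c * b' + d * d' = t * D := by norm_num) :
    normSlash m f A B C D = normSlash m f a' b' c' d' := by
  rw [← normSlash_comp_eq t h h' hD ht hA hB hC hE, hf]

variable {e l₂ l₃ : ℂ}

/-- Conjugation by the Fricke involution. -/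
lemma fricke_conj (hW : normSlash m f 0 (-1) 13 0 = e • f) (t : ℝ)
    {a b c d A B C D : ℝ}
    (h : 0 < a * d - b * c := by norm_num) (hD : 0 < A * D - B * C := by norm_num)
    (ht : t ≠ 0 := by norm_num)
    (hA : b * 13 = t * -C := by norm_num) (hB : -a = t * -D := by norm_num)
    (hC : d * 13 = t * (13 * A) := by norm_num) (hE : -c = t * (13 * B) := by norm_num) :
    normSlash m (normSlash m f a b c d) 0 (-1) 13 0 = e • normSlash m f A B C D := by
  have h13 : (0 : ℝ) < 0 * 0 - -1 * 13 := by norm_num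
  have hP : 0 < (0 * A + -1 * C) * (13 * B + 0 * D) - (0 * B + -1 * D) * (13 * A + 0 * C) := by
    nlinarith
  rw [← normSlash_smul, ← hW, normSlash_comp h13 hD, normSlash_comp h h13,
    ← normSlash_scale ht hP]
  congr 1 <;> linarith

/-- The matrix (1 0; 13 1) is the conjugate by W of the translation by -1. -/
lemma lowerUnipotent_invariant (he : e ≠ 0) (hT : ∀ n : ℤ, normSlash m f 1 n 0 1 = f)
    (hW : normSlash m f 0 (-1) 13 0 = e • f) : normSlash m f 1 0 13 1 = f := by
  have h1 : normSlash m f 1 (-1) 0 1 = f := by simpa using hT (-1)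
  have h2 := fricke_conj hW (A := 1) (B := 0) (C := 13) (D := 1) (a := 1) (b := -1) (c := 0)
    (d := 1) 1
  rw [h1, hW] at h2
  exact (smul_right_injective _ he h2).symm

/-- W exchanges the terms (2 0; 0 1) and (1 0; 0 2) of T₂ and carries (1 1; 0 2) to (2 0; -13 1).
Since T₂ has the same eigenvalue after conjugation, these last two act equally on f; their quotient
is an invariance matrix. Using (1 -1; 0 2) instead gives the second one. -/
lemma invariant_of_hecke_two (he : e ≠ 0) (hT : ∀ n : ℤ, normSlash m f 1 n 0 1 = f)
    (hW : normSlash m f 0 (-1) 13 0 = e • f)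
    (h2 : normSlash m f 2 0 0 1 + normSlash m f 1 0 0 2 + normSlash m f 1 1 0 2 = l₂ • f) :
    normSlash m f 7 1 13 2 = f ∧ normSlash m f 7 (-1) (-13) 2 = f := by
  have hsh : normSlash m f 1 (-1) 0 2 = normSlash m f 1 1 0 2 :=
    normSlash_of_invariant 1 (a := 1) (b := -1) (c := 0) (d := 1) (by simpa using hT (-1))
  have k1 : normSlash m (normSlash m f 2 0 0 1) 0 (-1) 13 0 = e • normSlash m f 1 0 0 2 :=
    fricke_conj hW 1
  have k2 : normSlash m (normSlash m f 1 0 0 2) 0 (-1) 13 0 = e • normSlash m f 2 0 0 1 :=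
    fricke_conj hW 1
  have k3 : normSlash m (normSlash m f 1 1 0 2) 0 (-1) 13 0 = e • normSlash m f 2 0 (-13) 1 :=
    fricke_conj hW 1
  have k4 : normSlash m (normSlash m f 1 (-1) 0 2) 0 (-1) 13 0 = e • normSlash m f 2 0 13 1 :=
    fricke_conj hW 1
  have hconj := congrArg (fun u => normSlash m u 0 (-1) 13 0) h2
  simp only [normSlash_add, normSlash_smul, hW, k1, k2, k3] at hconj
  rw [smul_comm, ← smul_add, ← smul_add] at hconj
  have key := smul_right_injective _ he hconj
  have key1 : normSlash m f 2 0 (-13) 1 = normSlash m f 1 1 0 2 := by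
    simp only [← h2] at key
    rw [add_comm (normSlash m f 1 0 0 2)] at key
    exact add_left_cancel key
  have key2 : normSlash m f 2 0 13 1 = normSlash m f 1 (-1) 0 2 := by
    rw [hsh, k3] at k4
    rw [hsh, ← key1]
    exact smul_right_injective _ he k4.symm
  constructor
  · have := congrArg (fun u => normSlash m u 1 0 13 2) key1
    beta_reduce at this
    rw [normSlash_comp_scalar 2, normSlash_comp_eq (A := 7) (B := 1) (C := 13) (D := 2) 2] at this
    exact this.symm
  · have := congrArg (fun u => normSlash m u 1 0 (-13) 2) key2
    beta_reduce at this
    rw [normSlash_comp_scalar 2,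
      normSlash_comp_eq (A := 7) (B := -1) (C := -13) (D := 2) 2] at this
    exact this.symm

/-- The argument used for T₂ now leaves two unmatched terms on each side, `f|(3 0; -13 1) + f|(3 0;
13 1) = f|(1 1; 0 3) + f|(1 -1; 0 3)`. Pairing each left term with a right one turns this into a
link between the defects of two elliptic matrices, not into the vanishing of either. -/
lemma hecke_three_relation (he : e ≠ 0) (hT : ∀ n : ℤ, normSlash m f 1 n 0 1 = f)
    (hW : normSlash m f 0 (-1) 13 0 = e • f)
    (h3 : normSlash m f 3 0 0 1 + normSlash m f 1 0 0 3 + normSlash m f 1 1 0 3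
      + normSlash m f 1 2 0 3 = l₃ • f) :
    f - normSlash m f (-4) 1 (-13) 3 =
      -normSlash m (f - normSlash m f (-4) (-1) 13 3) 3 0 (-26) 3 := by
  have hsh : normSlash m f 1 2 0 3 = normSlash m f 1 (-1) 0 3 :=
    normSlash_of_invariant 1 (a := 1) (b := 1) (c := 0) (d := 1) (by simpa using hT 1)
  rw [hsh] at h3
  have k1 : normSlash m (normSlash m f 3 0 0 1) 0 (-1) 13 0 = e • normSlash m f 1 0 0 3 :=
    fricke_conj hW 1
  have k2 : normSlash m (normSlash m f 1 0 0 3) 0 (-1) 13 0 = e • normSlash m f 3 0 0 1 :=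
    fricke_conj hW 1
  have k3 : normSlash m (normSlash m f 1 1 0 3) 0 (-1) 13 0 = e • normSlash m f 3 0 (-13) 1 :=
    fricke_conj hW 1
  have k4 : normSlash m (normSlash m f 1 (-1) 0 3) 0 (-1) 13 0 = e • normSlash m f 3 0 13 1 :=
    fricke_conj hW 1
  have hconj := congrArg (fun u => normSlash m u 0 (-1) 13 0) h3
  simp only [normSlash_add, normSlash_smul, hW, k1, k2, k3, k4] at hconj
  rw [smul_comm, ← smul_add, ← smul_add, ← smul_add] at hconj
  have key := smul_right_injective _ he hconj
  simp only [← h3] at key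
  have key1 : normSlash m f 3 0 (-13) 1 + normSlash m f 3 0 13 1 =
      normSlash m f 1 1 0 3 + normSlash m f 1 (-1) 0 3 := by
    linear_combination (exp := 1) key
  have c1 : normSlash m (normSlash m f (-4) 1 (-13) 3) 3 0 13 1 = normSlash m f 1 1 0 3 :=
    normSlash_comp_eq 1
  have c2 : normSlash m (normSlash m f (-4) (-1) 13 3) 3 0 (-13) 1 = normSlash m f 1 (-1) 0 3 :=
    normSlash_comp_eq 1
  apply normSlash_injective (a := 3) (b := 0) (c := 13) (d := 1) (by norm_num)
  have c3 : normSlash m (normSlash m (f - normSlash m f (-4) (-1) 13 3) 3 0 (-26) 3) 3 0 13 1 =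
      normSlash m (f - normSlash m f (-4) (-1) 13 3) 3 0 (-13) 1 := normSlash_comp_eq 3
  rw [normSlash_neg, c3, normSlash_sub, normSlash_sub, c1, c2]
  linear_combination (exp := 1) key1

/-- The four relations satisfied by `h = f - f|A`, where `A` is an elliptic element of order 3. -/
lemma order_three_defect_relations (he : e ≠ 0) (hT : ∀ n : ℤ, normSlash m f 1 n 0 1 = f)
    (hW : normSlash m f 0 (-1) 13 0 = e • f)
    (h2 : normSlash m f 2 0 0 1 + normSlash m f 1 0 0 2 + normSlash m f 1 1 0 2 = l₂ • f)
    (h3 : normSlash m f 3 0 0 1 + normSlash m f 1 0 0 3 + normSlash m f 1 1 0 3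
      + normSlash m f 1 2 0 3 = l₃ • f)
    {h : ℍ → ℂ} (hh : h = f - normSlash m f (-4) (-1) 13 3) :
    h + normSlash m h (-4) (-1) 13 3 + normSlash m h 3 1 (-13) (-4) = 0 ∧
    normSlash m h (-5) (-1) 26 5 = -h ∧
    normSlash m h 39 9 (-182) (-39) = e • h ∧
    normSlash m h 20 3 (-52) (-6) = h := by
  obtain ⟨i1, i2⟩ := invariant_of_hecke_two he hT hW h2
  have iV := lowerUnipotent_invariant he hT hW
  have hg := hecke_three_relation he hT hW h3
  rw [← hh] at hg
  have T1 : normSlash m f 1 1 0 1 = f := by simpa using hT 1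
  have T1' : normSlash m f 1 (-1) 0 1 = f := by simpa using hT (-1)
  have iγ : normSlash m f (-6) (-1) 13 2 = f :=
    (normSlash_of_invariant 1 T1' (a' := 7) (b' := 1) (c' := 13) (d' := 2)).trans i1
  have iγ' : normSlash m f (-6) 1 (-13) 2 = f :=
    (normSlash_of_invariant 1 T1 (a' := 7) (b' := -1) (c' := -13) (d' := 2)).trans i2
  have iγi : normSlash m f 2 1 (-13) (-6) = f := by
    have := normSlash_inv (by norm_num) iγ
    simpa using this
  have ainv : normSlash m h 3 1 (-13) (-4) = normSlash m f 3 1 (-13) (-4) - f := by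
    rw [hh, normSlash_sub, normSlash_comp_scalar 1]
  refine ⟨?_, ?_, ?_, ?_⟩
  -- The sum telescopes because A has trace -1 and determinant 1, so A³ = 1; here A² = (3 1; -13
  -- -4).
  · have c1 : normSlash m (normSlash m f (-4) (-1) 13 3) (-4) (-1) 13 3 =
        normSlash m f 3 1 (-13) (-4) := normSlash_comp_eq 1
    rw [ainv, hh, normSlash_sub, c1]
    abel
  -- Up to invariance matrices of f, the involution (-5 -1; 26 5) swaps f and `f|A`.
  · have c1 : normSlash m f (-5) (-1) 26 5 = normSlash m f (-4) (-1) 13 3 :=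
      normSlash_of_invariant (-1) iγi
    have c2 : normSlash m (normSlash m f (-4) (-1) 13 3) (-5) (-1) 26 5 = f :=
      (normSlash_comp_eq 1 (A := -6) (B := -1) (C := 13) (D := 2)).trans iγ
    rw [hh, normSlash_sub, c1, c2]
    abel
  -- `h|W` is e times the defect of (3 -1; 13 -4), the inverse of (-4 1; -13 3), and the T₃ relation
  -- expresses that defect through h again.
  · have c1 : normSlash m (normSlash m f (-4) (-1) 13 3) 0 (-1) 13 0 =
        e • normSlash m f 3 (-1) 13 (-4) := fricke_conj hW 1
    have c2 : normSlash m (f - normSlash m f (-4) 1 (-13) 3) 3 (-1) 13 (-4) =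
        normSlash m f 3 (-1) 13 (-4) - f := by
      rw [normSlash_sub, normSlash_comp_scalar 1]
    have c3 : normSlash m (normSlash m h 3 0 (-26) 3) 3 (-1) 13 (-4) =
        normSlash m h 9 (-3) (-39) 14 := normSlash_comp_eq 1
    have c4 : normSlash m h 0 (-1) 13 0 = e • normSlash m h 9 (-3) (-39) 14 := by
      rw [hg, normSlash_neg, c3] at c2
      have : normSlash m h 0 (-1) 13 0 = e • f - e • normSlash m f 3 (-1) 13 (-4) := by
        conv_lhs => rw [hh, normSlash_sub, hW, c1]
      rw [this, ← smul_sub]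
      congr 1
      rw [← neg_sub, ← c2, neg_neg]
    have c5 := congrArg (fun u => normSlash m u 14 3 39 9) c4
    simp only [normSlash_smul] at c5
    rw [normSlash_comp_eq (A := 39) (B := 9) (C := -182) (D := -39) (-1),
      normSlash_comp_scalar 9] at c5
    exact c5
  -- Apply the invariance matrix (-6 1; -13 2) to the T₂ equation. It permutes the three terms up to
  -- defects of elliptic matrices; the terms in f cancel and two translates of h must agree.
  · have iV' : normSlash m f (-12) 1 (-13) 1 = f := by
      have iVi : normSlash m f 1 0 (-13) 1 = f := by
        simpa using normSlash_inv (by norm_num) iV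
      exact (normSlash_of_invariant 1 T1 (a' := 1) (b' := 0) (c' := -13) (d' := 1)).trans iVi
    have iγ2 : normSlash m f (-2) 1 13 (-7) = f := by
      have := normSlash_inv (by norm_num) i1
      rw [← normSlash_scale (t := -1) (by norm_num) (by norm_num)] at this
      norm_num at this
      exact this
    have d1 : normSlash m (normSlash m f 2 0 0 1) (-6) 1 (-13) 2 = normSlash m f 1 0 0 2 := by
      rw [normSlash_comp_eq (A := -12) (B := 2) (C := -13) (D := 2) 1]
      exact normSlash_of_invariant 1 iV'
    have d2 : normSlash m (normSlash m f 1 0 0 2) (-6) 1 (-13) 2 =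
        normSlash m (normSlash m f 3 (-1) 13 (-4)) 2 0 0 1 := by
      rw [normSlash_comp_eq (A := -6) (B := 1) (C := -26) (D := 4) 1,
        normSlash_comp_eq (A := -6) (B := 1) (C := -26) (D := 4) (-1)]
    have d3 : normSlash m (normSlash m f 1 1 0 2) (-6) 1 (-13) 2 =
        normSlash m f 7 (-1) (-26) 4 := by
      rw [normSlash_comp_eq (A := -19) (B := 3) (C := -26) (D := 4) 1]
      exact (normSlash_of_invariant 1 T1' (a' := -19) (b' := 3) (c' := -26) (d' := 4)).symm
    have d4 : normSlash m f 7 (-1) (-26) 4 =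
        normSlash m f 1 1 0 2 + normSlash m h 7 (-1) (-26) 4 := by
      have q1 (u : ℍ → ℂ) : normSlash m (normSlash m (normSlash m u 3 1 (-13) (-4))
          (-2) 1 13 (-7)) 1 1 0 2 = normSlash m u 7 (-1) (-26) 4 := by
        rw [normSlash_comp_eq (f := u) (A := 7) (B := -4) (C := -26) (D := 15) 1]
        exact normSlash_comp_eq 1
      rw [← q1 h, ainv, normSlash_sub, normSlash_sub, q1, iγ2]
      abel
    have d5 : normSlash m f 3 (-1) 13 (-4) = f - normSlash m h 9 (-3) (-39) 14 := by
      have c2 : normSlash m (f - normSlash m f (-4) 1 (-13) 3) 3 (-1) 13 (-4) =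
          normSlash m f 3 (-1) 13 (-4) - f := by
        rw [normSlash_sub, normSlash_comp_scalar 1]
      have c3 : normSlash m (normSlash m h 3 0 (-26) 3) 3 (-1) 13 (-4) =
          normSlash m h 9 (-3) (-39) 14 := normSlash_comp_eq 1
      rw [hg, normSlash_neg, c3] at c2
      linear_combination (exp := 1) -c2
    have d6 : normSlash m (normSlash m h 9 (-3) (-39) 14) 2 0 0 1 =
        normSlash m h 18 (-3) (-78) 14 := normSlash_comp_eq 1
    have d7 := congrArg (fun u => normSlash m u (-6) 1 (-13) 2) h2
    simp only [normSlash_add, normSlash_smul, iγ', d1, d2, d3, d4, d5, normSlash_sub, d6] at d7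
    rw [← h2] at d7
    have d8 : normSlash m h 7 (-1) (-26) 4 = normSlash m h 18 (-3) (-78) 14 := by
      linear_combination (exp := 1) d7
    have d9 := congrArg (fun u => normSlash m u 14 3 78 18) d8
    beta_reduce at d9
    rw [normSlash_comp_eq (A := 20) (B := 3) (C := -52) (D := -6) 1,
      normSlash_comp_scalar 18] at d9
    exact d9

end Relations

end

/-! ### Rigidity of holomorphic functions invariant under dilations -/

noncomputable section

open UpperHalfPlane ModularForm Filter Topology

/-- The point `exp x * i` of the upper half-plane. -/
def expI (x : ℝ) : ℍ := ⟨Real.exp x * Complex.I, by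
  rw [Complex.mul_I_im, Complex.ofReal_re]; exact Real.exp_pos x⟩

lemma coe_expI (x : ℝ) : (expI x : ℂ) = Real.exp x * Complex.I := rfl

lemma continuous_expI : Continuous expI := by
  rw [isEmbedding_coe.continuous_iff]
  have : (UpperHalfPlane.coe ∘ expI) = fun x : ℝ => (Real.exp x : ℂ) * Complex.I := rfl
  rw [this]
  fun_prop

lemma expI_injective : Function.Injective expI := fun x y h => by
  have := congrArg (fun z : ℍ => (z : ℂ).im) h
  simp only [coe_expI, Complex.mul_I_im, Complex.ofReal_re] at this
  exact Real.exp_injective this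

/-- Holomorphic functions on `ℍ` which agree on a segment of the imaginary axis are equal. -/
lemma eq_of_eq_imaginary_axis {f g : ℍ → ℂ} (hf : MDifferentiable 𝓘(ℂ) 𝓘(ℂ) f)
    (hg : MDifferentiable 𝓘(ℂ) 𝓘(ℂ) g) {x₀ : ℝ} (h : ∀ x < x₀, f (expI x) = g (expI x)) :
    f = g := by
  rw [← sub_eq_zero]
  refine eq_zero_of_frequently (hf.sub hg) (τ := expI (x₀ - 1)) ?_
  have h1 : Tendsto expI (𝓝[≠] (x₀ - 1)) (𝓝[≠] (expI (x₀ - 1))) := by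
    refine tendsto_nhdsWithin_of_tendsto_nhds_of_eventually_within _
      (continuous_expI.continuousAt.mono_left nhdsWithin_le_nhds) ?_
    filter_upwards [self_mem_nhdsWithin] with x hx
    exact fun h => hx (expI_injective h)
  refine h1.frequently (Eventually.frequently ?_)
  filter_upwards [nhdsWithin_le_nhds (Iio_mem_nhds (sub_one_lt x₀))] with x hx
  simp [h x hx]

/-- A holomorphic function on `ℍ` invariant under two multiplicatively independent dilations is
constant. -/
lemma eq_const_of_dilation_invariant {u : ℍ → ℂ} (hu : MDifferentiable 𝓘(ℂ) 𝓘(ℂ) u) {s t : ℝ}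
    (hs : 0 < s) (ht : 0 < t) (hst : Irrational (Real.log s / Real.log t))
    (h1 : ∀ z, u (realGL s 0 0 1 • z) = u z) (h2 : ∀ z, u (realGL t 0 0 1 • z) = u z) :
    ∀ z, u z = u (expI 0) := by
  have hcont : Continuous fun x => u (expI x) := hu.continuous.comp continuous_expI
  have hshift : ∀ {r : ℝ}, 0 < r → ∀ x, realGL r 0 0 1 • expI x = expI (x + Real.log r) := by
    intro r hr x
    apply UpperHalfPlane.ext
    rw [coe_realGL_smul (by simpa using hr), coe_expI, coe_expI, Real.exp_add, Real.exp_log hr]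
    push_cast
    ring
  -- In the coordinate z = ieˣ dilations are translations, so P is the group of periods of u along
  -- the imaginary axis.
  let P : AddSubgroup ℝ :=
    { carrier := {p | ∀ x, u (expI (x + p)) = u (expI x)}
      zero_mem' := by simp
      add_mem' := by
        intro a b ha hb x
        rw [← add_assoc, hb, ha]
      neg_mem' := by
        intro a ha x
        rw [← ha (x + -a), neg_add_cancel_right] }
  have hP : Dense (P : Set ℝ) := by
    refine (dense_addSubgroupClosure_pair_iff.2 hst).mono ?_
    rw [SetLike.coe_subset_coe, AddSubgroup.closure_le]
    rintro p (rfl | rfl)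
    · exact fun x => by rw [← hshift hs, h1]
    · exact fun x => by rw [← hshift ht, h2]
  have hclosed : IsClosed {p : ℝ | u (expI p) = u (expI 0)} :=
    isClosed_eq hcont continuous_const
  have hall : ∀ x, u (expI x) = u (expI 0) := by
    intro x
    have : closure (P : Set ℝ) ⊆ {p : ℝ | u (expI p) = u (expI 0)} :=
      hclosed.closure_subset_iff.2 fun p hp => by simpa using hp 0
    exact this (hP x)
  have := eq_of_eq_imaginary_axis hu (mdifferentiable_const (c := u (expI 0)))
    (x₀ := 0) fun x _ => hall x
  exact fun z => congrFun this z

/-! ### Multiplicative independence in ℤ[(1 + √13)/2] -/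

section Irrationality

lemma sqrt_thirteen_sq : √13 * √13 = (13 : ℝ) := Real.mul_self_sqrt (by norm_num)

lemma int_eq_of_sqrt_thirteen {a b c d : ℤ}
    (h : (a + b * ((1 + √13) / 2) : ℝ) = c + d * ((1 + √13) / 2)) : a = c ∧ b = d := by
  have hirr : Irrational (√13) := by
    have := Nat.Prime.irrational_sqrt (p := 13) (by norm_num)
    exact_mod_cast this
  have hbd : b = d := by
    by_contra hne
    have hne' : ((b - d : ℤ) : ℝ) ≠ 0 := by exact_mod_cast sub_ne_zero.2 hne
    apply hirr
    refine ⟨((2 * (c - a) - (b - d) : ℤ) : ℚ) / ((b - d : ℤ) : ℚ), ?_⟩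
    push_cast at hne' ⊢
    rw [div_eq_iff hne']
    linarith
  subst hbd
  refine ⟨?_, rfl⟩
  have : (a : ℝ) = c := by linarith
  exact_mod_cast this

/-- With w = (1 + √13)/2 one has w² = w + 3 and w(w - 1) = 3, so a + bw ↦ a + b mod 3 is reduction
modulo the prime w - 1 above 3. It sends w to 1. -/
lemma pow_golden_form (n : ℕ) :
    ∃ a b : ℤ, ((1 + √13) / 2) ^ n = (a + b * ((1 + √13) / 2) : ℝ) ∧ (a + b) % 3 = 1 := by
  induction n with
  | zero => exact ⟨1, 0, by simp, by norm_num⟩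
  | succ n ih =>
    obtain ⟨a, b, h, hab⟩ := ih
    refine ⟨3 * b, a + b, ?_, by omega⟩
    rw [pow_succ, h]
    push_cast
    linear_combination (b / 4 : ℝ) * sqrt_thirteen_sq

/-- The same reduction kills w - 1 = (√13 - 1)/2, hence every product containing a positive power of
it. -/
lemma pow_conj_form (n q : ℕ) :
    ∃ a b : ℤ, ((3 + √13) / 2) ^ q * ((√13 - 1) / 2) ^ (n + 1) =
      (a + b * ((1 + √13) / 2) : ℝ) ∧ (a + b) % 3 = 0 := by
  induction q with
  | zero =>
    induction n with
    | zero => exact ⟨-1, 1, by push_cast; ring, by norm_num⟩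
    | succ n ih =>
      obtain ⟨a, b, h, hab⟩ := ih
      refine ⟨3 * b - a, a, ?_, by omega⟩
      rw [pow_succ, ← mul_assoc, h]
      push_cast
      linear_combination (b / 4 : ℝ) * sqrt_thirteen_sq
  | succ q ih =>
    obtain ⟨a, b, h, hab⟩ := ih
    refine ⟨a + 3 * b, a + 2 * b, ?_, by omega⟩
    rw [pow_succ, mul_right_comm, h]
    push_cast
    linear_combination (b / 4 : ℝ) * sqrt_thirteen_sq

lemma sqrt_thirteen_bounds : (3 : ℝ) < √13 ∧ √13 < 4 :=
  ⟨Real.lt_sqrt_of_sq_lt (by norm_num), (Real.sqrt_lt' (by norm_num)).2 (by norm_num)⟩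

/-- The two ratios are (w/w')² and (vw'/w)⁴, where ww' = 3 and v is a unit of norm -1. A rational
ratio of logarithms would make some positive power of w equal to a unit times the same power of w',
contradicting reduction modulo w'. -/
lemma irrational_log_ratio :
    Irrational (Real.log ((7 + √13) / (7 - √13)) / Real.log ((17 + 4 * √13) / (17 - 4 * √13))) := by
  obtain ⟨hq3, hq4⟩ := sqrt_thirteen_bounds
  set w : ℝ := (1 + √13) / 2 with hw
  set w' : ℝ := (√13 - 1) / 2 with hw'
  set v : ℝ := (3 + √13) / 2 with hv
  have hsq := sqrt_thirteen_sq
  have hwpos : 0 < w := by rw [hw]; linarith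
  have hw'pos : 0 < w' := by rw [hw']; linarith
  have hvpos : 0 < v := by rw [hv]; linarith
  have e1 : (7 + √13) / (7 - √13) = (w / w') ^ 2 := by
    rw [div_pow, div_eq_div_iff (by linarith) (by positivity), hw, hw']
    nlinarith
  have e2 : (17 + 4 * √13) / (17 - 4 * √13) = (v * w' / w) ^ 4 := by
    have : v * w' / w = (2 + √13) / 3 := by
      rw [div_eq_div_iff hwpos.ne' (by norm_num), hw, hw', hv]
      nlinarith
    have h17 : 0 < 17 - 4 * √13 := by nlinarith
    rw [this, div_pow, div_eq_div_iff h17.ne' (by norm_num)]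
    have h4 : (2 + √13) ^ 4 = 497 + 136 * √13 := by
      have : (2 + √13) ^ 2 = 17 + 4 * √13 := by nlinarith
      rw [show (4 : ℕ) = 2 * 2 by norm_num, pow_mul, this]
      nlinarith
    rw [h4]
    nlinarith
  have hlt1 : 1 < w / w' := by rw [one_lt_div hw'pos, hw, hw']; linarith
  have hlt2 : 1 < v * w' / w := by
    rw [one_lt_div hwpos, hw, hw', hv]; nlinarith
  have hl1 := Real.log_pos hlt1
  have hl2 := Real.log_pos hlt2
  rw [e1, e2, Real.log_pow, Real.log_pow]
  rintro ⟨r, hr⟩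
  have hrpos : 0 < r := by
    have : (0 : ℝ) < r := by rw [hr]; positivity
    exact_mod_cast this
  have hnum : ((r.num.toNat : ℕ) : ℝ) = (r.num : ℝ) := by
    have : ((r.num.toNat : ℕ) : ℤ) = r.num := Int.toNat_of_nonneg (Rat.num_pos.2 hrpos).le
    exact_mod_cast this
  set n := r.num.toNat
  have hden : (r.den : ℝ) ≠ 0 := by exact_mod_cast r.den_ne_zero
  have hr' : (r : ℝ) = n / r.den := by rw [hnum]; exact_mod_cast (Rat.num_div_den r).symm
  rw [hr', div_eq_div_iff hden (by positivity)] at hr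
  push_cast at hr
  have hlog : Real.log ((w / w') ^ r.den) = Real.log ((v * w' / w) ^ (2 * n)) := by
    rw [Real.log_pow, Real.log_pow]
    push_cast
    linarith
  have hpow : (w / w') ^ r.den = (v * w' / w) ^ (2 * n) :=
    Real.log_injOn_pos (Set.mem_Ioi.2 (by positivity)) (Set.mem_Ioi.2 (by positivity)) hlog
  have hkey : w ^ (r.den + 2 * n) = v ^ (2 * n) * w' ^ (r.den + 2 * n) := by
    rw [div_pow w, div_pow (v * w'), mul_pow v, div_eq_div_iff (by positivity) (by positivity)] at hpow
    rw [pow_add, pow_add]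
    linear_combination hpow
  -- The exponent must be positive for the side containing w' to reduce to 0.
  obtain ⟨d, hd⟩ : ∃ d, r.den + 2 * n = d + 1 := ⟨r.den + 2 * n - 1, by have := r.pos; omega⟩
  rw [hd] at hkey
  obtain ⟨a, b, h1, h1'⟩ := pow_golden_form (d + 1)
  obtain ⟨a', b', h2, h2'⟩ := pow_conj_form d (2 * n)
  rw [h1, h2] at hkey
  obtain ⟨rfl, rfl⟩ := int_eq_of_sqrt_thirteen hkey
  omega

end Irrationality

end

/-! ### Vanishing of the order 3 defect -/

noncomputable section

open UpperHalfPlane ModularForm Filter Topology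

section Vanishing

variable {m : ℕ} {h : ℍ → ℂ}

lemma realGL_scale_smul {a b c d t : ℝ} (ht : t ≠ 0) (h : 0 < a * d - b * c) (z : ℍ) :
    realGL (t * a) (t * b) (t * c) (t * d) • z = realGL a b c d • z := by
  have h' : 0 < t * a * (t * d) - t * b * (t * c) := by
    have : t * a * (t * d) - t * b * (t * c) = t ^ 2 * (a * d - b * c) := by ring
    rw [this]; positivity
  have ht' : (t : ℂ) ≠ 0 := by exact_mod_cast ht
  apply UpperHalfPlane.ext
  rw [coe_realGL_smul h, coe_realGL_smul h']
  push_cast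
  rw [show (t * a * z + t * b : ℂ) = t * (a * z + b) by ring,
    show (t * c * z + t * d : ℂ) = t * (c * z + d) by ring, mul_div_mul_left _ _ ht']

/-- The value of `h * Q ^ m` is unchanged by a matrix fixing both `h` and the form `Q`. -/
lemma mul_form_pow_invariant {a b c d : ℝ} (hD : 0 < a * d - b * c) {Q : ℂ → ℂ}
    (hh : normSlash m h a b c d = h)
    (hQ : ∀ z : ℍ, Q ((a * z + b) / (c * z + d)) * (c * z + d) ^ 2 =
      ((a * d - b * c : ℝ) : ℂ) * Q z) (z : ℍ) :
    h (realGL a b c d • z) * Q (realGL a b c d • z : ℍ) ^ m = h z * Q z ^ m := by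
  have hc := linear_ne_zero_of_det_pos hD z
  have h1 : h z = (((a * d - b * c : ℝ) : ℂ) / (c * z + d) ^ 2) ^ m * h (realGL a b c d • z) :=
    (congrFun hh z).symm
  rw [h1, coe_realGL_smul hD]
  have h2 : Q ((a * z + b) / (c * z + d)) =
      ((a * d - b * c : ℝ) : ℂ) / (c * z + d) ^ 2 * Q z := by
    rw [div_mul_eq_mul_div, eq_div_iff (pow_ne_zero _ hc), hQ]
  rw [h2, mul_pow]
  ring

lemma form_div_mul_sq {x y : ℂ} (hy : y ≠ 0) :
    (52 * (x / y) ^ 2 + 26 * (x / y) + 3) * y ^ 2 = 52 * x ^ 2 + 26 * x * y + 3 * y ^ 2 := by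
  field_simp

/-- Both matrices fix the roots (±√13 - 13)/52 of Q and preserve Q up to their determinant, so h·Qᵐ
is an invariant function of weight 0. Their eigenvalues are 7 ± √13 and 17 ± 4√13. -/
lemma mul_form_pow_const (hh : MDifferentiable 𝓘(ℂ) 𝓘(ℂ) h)
    (h1 : normSlash m h 20 3 (-52) (-6) = h) (h2 : normSlash m h (-35) (-12) 208 69 = h) :
    ∃ C : ℂ, ∀ z : ℍ, h z * (52 * (z : ℂ) ^ 2 + 26 * z + 3) ^ m = C := by
  obtain ⟨hq3, hq4⟩ := sqrt_thirteen_bounds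
  have hsq := sqrt_thirteen_sq
  set q := √13 with hq
  let Q : ℂ → ℂ := fun z => 52 * z ^ 2 + 26 * z + 3
  let F : ℍ → ℂ := fun z => h z * Q z ^ m
  have hF : MDifferentiable 𝓘(ℂ) 𝓘(ℂ) F := by
    refine hh.mul ?_
    have hd : Differentiable ℂ fun z : ℂ => Q z ^ m := by fun_prop
    exact hd.mdifferentiable.comp mdifferentiable_coe
  have k1 : ∀ z, F (realGL 20 3 (-52) (-6) • z) = F z := by
    refine mul_form_pow_invariant (by norm_num) h1 fun z => ?_
    have hc := linear_ne_zero_of_det_pos (a := 20) (b := 3) (c := -52) (d := -6) (by norm_num) z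
    simp only [Q]
    rw [form_div_mul_sq hc]
    push_cast
    ring
  have k2 : ∀ z, F (realGL (-35) (-12) 208 69 • z) = F z := by
    refine mul_form_pow_invariant (by norm_num) h2 fun z => ?_
    have hc := linear_ne_zero_of_det_pos (a := -35) (b := -12) (c := 208) (d := 69)
      (by norm_num) z
    simp only [Q]
    rw [form_div_mul_sq hc]
    push_cast
    ring
  -- The matrix (q - 13, -q - 13; 52, 52) sends ∞ and 0 to the two roots of Q, so conjugation by it
  -- turns both hyperbolic matrices into dilations.
  have hσ' : 0 < (q - 13) * 52 - (-q - 13) * 52 := by nlinarith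
  have h17 : 0 < 17 - 4 * q := by nlinarith
  have d1 : 0 < (7 + q) / (7 - q) := div_pos (by linarith) (by linarith)
  have d2 : 0 < (17 + 4 * q) / (17 - 4 * q) := div_pos (by linarith) h17
  have hconst := eq_const_of_dilation_invariant
    (u := fun z => F (realGL (q - 13) (-q - 13) 52 52 • z))
    (hF.comp (mdifferentiable_smul (by rwa [det_realGL hσ']))) d1 d2 irrational_log_ratio
    (fun z => ?_) (fun z => ?_)
  · refine ⟨F (realGL (q - 13) (-q - 13) 52 52 • expI 0), fun z => ?_⟩
    have := hconst ((realGL (q - 13) (-q - 13) 52 52)⁻¹ • z)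
    simp only [smul_inv_smul] at this
    exact this
  · rw [← k1 (realGL (q - 13) (-q - 13) 52 52 • realGL ((7 + q) / (7 - q)) 0 0 1 • z)]
    congr 1
    have hd : 0 < (7 + q) / (7 - q) * 1 - 0 * 0 := by simpa using d1
    have hP := mul_pos hσ' hd
    have h7 : 7 - q ≠ 0 := by linarith
    rw [← mul_smul, ← mul_smul, mul_assoc, realGL_mul hσ' hd,
      realGL_mul (by norm_num) (by linarith),
      ← realGL_scale_smul (t := 7 + q) (by positivity) hσ']
    congr 2 <;> field_simp <;> nlinarith
  · rw [← k2 (realGL (q - 13) (-q - 13) 52 52 • z)]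
    congr 1
    have hd : 0 < (17 + 4 * q) / (17 - 4 * q) * 1 - 0 * 0 := by simpa using d2
    have hP := mul_pos hσ' hd
    rw [← mul_smul, ← mul_smul, realGL_mul hσ' hd, realGL_mul (by norm_num) hσ',
      ← realGL_scale_smul (t := 17 - 4 * q) h17.ne' (by linarith)]
    congr 2 <;> field_simp <;> nlinarith

lemma eq_zero_of_order_three_relations {e : ℂ} (hm : 0 < m) (hh : MDifferentiable 𝓘(ℂ) 𝓘(ℂ) h)
    (he : e * e = 1)
    (hA : h + normSlash m h (-4) (-1) 13 3 + normSlash m h 3 1 (-13) (-4) = 0)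
    (hB : normSlash m h (-5) (-1) 26 5 = -h)
    (hτ : normSlash m h 39 9 (-182) (-39) = e • h)
    (hκ : normSlash m h 20 3 (-52) (-6) = h) : h = 0 := by
  -- The product (-13 -6; 104 39) of the matrices in `hB` and `hτ` acts on h by -e. Its square is
  -- 13·(-35 -12; 208 69), and e² = 1.
  have hN : normSlash m h (-35) (-12) 208 69 = h := by
    have c1 : normSlash m h (-13) (-6) 104 39 = -(e • h) := by
      rw [← normSlash_comp_eq (a := -5) (b := -1) (c := 26) (d := 5) (a' := 39) (b' := 9)
        (c' := -182) (d' := -39) 1, hB, normSlash_neg, hτ]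
    rw [← normSlash_comp_eq (a := -13) (b := -6) (c := 104) (d := 39) (a' := -13) (b' := -6)
        (c' := 104) (d' := 39) 13, c1, normSlash_neg, normSlash_smul, c1, smul_neg, neg_neg,
        smul_smul, he, one_smul]
  obtain ⟨C, hC⟩ := mul_form_pow_const hh hκ hN
  obtain ⟨hq3, hq4⟩ := sqrt_thirteen_bounds
  have hsq := sqrt_thirteen_sq
  have hQ0 : ∀ z : ℍ, (52 * (z : ℂ) ^ 2 + 26 * z + 3 : ℂ) ≠ 0 := by
    intro z hz
    have : (52 * (z : ℂ) + 13 - (√13 : ℝ)) * (52 * (z : ℂ) + 13 + (√13 : ℝ)) = 0 := by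
      have h' : ((√13 : ℝ) : ℂ) * (√13 : ℝ) = 13 := by exact_mod_cast hsq
      linear_combination 52 * hz - h'
    rcases mul_eq_zero.1 this with h0 | h0
    · exact z.ne_ofReal ((√13 - 13) / 52) (by push_cast; linear_combination h0 / 52)
    · exact z.ne_ofReal ((-√13 - 13) / 52) (by push_cast; linear_combination h0 / 52)
  suffices hC0 : C = 0 by
    funext z
    have := hC z
    rw [hC0, mul_eq_zero] at this
    exact this.resolve_right (pow_ne_zero _ (hQ0 z))
  by_contra hC0
  have hval : ∀ {a b c d : ℝ}, 0 < a * d - b * c → ∀ z : ℍ,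
      normSlash m h a b c d z * (52 * (a * z + b) ^ 2 + 26 * (a * z + b) * (c * z + d)
        + 3 * (c * z + d) ^ 2) ^ m = ((a * d - b * c : ℝ) : ℂ) ^ m * C := by
    intro a b c d hD z
    have hc := linear_ne_zero_of_det_pos hD z
    have := hC (realGL a b c d • z)
    rw [coe_realGL_smul hD] at this
    rw [← form_div_mul_sq hc, ← this, normSlash]
    rw [mul_pow, div_pow]
    field_simp
  -- The three quadratics are Q and its transforms by A and A². With h = CQ⁻ᵐ, `hA` with
  -- denominators cleared reads C·P = 0.
  let P : ℂ → ℂ := fun z => ((-13 * z ^ 2 + 1) * (-39 * z ^ 2 - 26 * z - 4)) ^ m +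
    ((52 * z ^ 2 + 26 * z + 3) * (-39 * z ^ 2 - 26 * z - 4)) ^ m +
    ((52 * z ^ 2 + 26 * z + 3) * (-13 * z ^ 2 + 1)) ^ m
  have hP : ∀ z : ℍ, P z = 0 := by
    intro z
    have v0 := hC z
    have v1 := hval (a := -4) (b := -1) (c := 13) (d := 3) (by norm_num) z
    have v2 := hval (a := 3) (b := 1) (c := -13) (d := -4) (by norm_num) z
    have hs := congrFun hA z
    simp only [Pi.add_apply, Pi.zero_apply] at hs
    push_cast at v1 v2
    rw [show (52 * (-4 * (z : ℂ) + -1) ^ 2 + 26 * (-4 * z + -1) * (13 * z + 3) +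
      3 * (13 * z + 3) ^ 2) = -13 * z ^ 2 + 1 by ring,
      show ((-4 * 3 - -1 * 13 : ℂ)) = 1 by norm_num, one_pow, one_mul] at v1
    rw [show (52 * (3 * (z : ℂ) + 1) ^ 2 + 26 * (3 * z + 1) * (-13 * z + -4) +
      3 * (-13 * z + -4) ^ 2) = -39 * z ^ 2 - 26 * z - 4 by ring,
      show ((3 * -4 - 1 * -13 : ℂ)) = 1 by norm_num, one_pow, one_mul] at v2
    have : C * P z = 0 := by
      simp only [P, mul_pow]
      generalize (52 * (z : ℂ) ^ 2 + 26 * z + 3) ^ m = q0 at *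
      generalize (-13 * (z : ℂ) ^ 2 + 1) ^ m = q1 at *
      generalize (-39 * (z : ℂ) ^ 2 - 26 * z - 4) ^ m = q2 at *
      linear_combination q0 * q1 * q2 * hs - q1 * q2 * v0 - q0 * q2 * v1 - q0 * q1 * v2
    exact (mul_eq_zero.1 this).resolve_left hC0
  -- By continuity P also vanishes at this real root of Q, where only its first term survives, and
  -- that term is nonzero.
  let r : ℝ := (√13 - 13) / 52
  have hr : P r = 0 := by
    have hcont : Continuous fun y : ℝ => P (r + y * Complex.I) := by fun_prop
    have hcl : IsClosed {y : ℝ | P (r + y * Complex.I) = 0} :=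
      isClosed_eq hcont continuous_const
    have hsub : closure (Set.Ioi (0 : ℝ)) ⊆ {y : ℝ | P (r + y * Complex.I) = 0} :=
      hcl.closure_subset_iff.2 fun y hy =>
        hP ⟨r + y * Complex.I, by simpa using hy⟩
    have h0 : (0 : ℝ) ∈ closure (Set.Ioi (0 : ℝ)) := by rw [closure_Ioi]; exact Set.self_mem_Ici
    simpa using hsub h0
  have hQr : 52 * r ^ 2 + 26 * r + 3 = 0 := by simp only [r]; nlinarith
  have hQr' : (52 * (r : ℂ) ^ 2 + 26 * r + 3) = 0 := by exact_mod_cast hQr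
  simp only [P, hQr', zero_mul, zero_pow hm.ne', add_zero] at hr
  have hr2 := eq_zero_of_pow_eq_zero hr
  have hr3 : (-13 * r ^ 2 + 1) * (-39 * r ^ 2 - 26 * r - 4) = 0 := by exact_mod_cast hr2
  rcases mul_eq_zero.1 hr3 with h0 | h0 <;> simp only [r] at h0 <;> nlinarith

end Vanishing

end

/-! ### From enough invariance matrices to Γ₀(13) -/

noncomputable section

open UpperHalfPlane ModularForm

section Generation

variable {m : ℕ} {f : ℍ → ℂ}

/-- Every nonzero residue class mod 13 is the upper left entry of an invariance matrix with
lower left entry 13. -/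
lemma exists_invariant_of_hecke {e l₂ l₃ : ℂ} (hm : 0 < m) (hf : MDifferentiable 𝓘(ℂ) 𝓘(ℂ) f)
    (he : e * e = 1) (hT : ∀ n : ℤ, normSlash m f 1 n 0 1 = f)
    (hW : normSlash m f 0 (-1) 13 0 = e • f)
    (h2 : normSlash m f 2 0 0 1 + normSlash m f 1 0 0 2 + normSlash m f 1 1 0 2 = l₂ • f)
    (h3 : normSlash m f 3 0 0 1 + normSlash m f 1 0 0 3 + normSlash m f 1 1 0 3
      + normSlash m f 1 2 0 3 = l₃ • f) (x : ℤ) (hx : ¬ (13 : ℤ) ∣ x) :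
    ∃ x₀ y w : ℤ, (13 : ℤ) ∣ x - x₀ ∧ x₀ * w - y * 13 = 1 ∧ normSlash m f x₀ y 13 w = f := by
  have he0 : e ≠ 0 := fun h => by simp [h] at he
  obtain ⟨i1, i2⟩ := invariant_of_hecke_two he0 hT hW h2
  have iV := lowerUnipotent_invariant he0 hT hW
  have hg := hecke_three_relation he0 hT hW h3
  obtain ⟨r1, r2, r3, r4⟩ := order_three_defect_relations he0 hT hW h2 h3 rfl
  have h0 := eq_zero_of_order_three_relations hm (hf.sub (hf.normSlash (by norm_num))) he r1 r2 r3 r4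
  have iA : normSlash m f (-4) (-1) 13 3 = f := (sub_eq_zero.1 h0).symm
  rw [h0, normSlash_zero, neg_zero] at hg
  have iA' : normSlash m f (-4) 1 (-13) 3 = f := (sub_eq_zero.1 hg).symm
  have flip {a b c d : ℝ} (h : 0 < a * d - b * c) (hi : normSlash m f a b c d = f) :
      normSlash m f (-a) (-b) (-c) (-d) = f := by
    have := normSlash_scale (m := m) (f := f) (t := -1) (by norm_num) h
    simp only [neg_mul, one_mul] at this
    rw [this, hi]
  have flipInv {a b c d : ℝ} (h : 0 < a * d - b * c) (hi : normSlash m f a b c d = f) :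
      normSlash m f (-d) b c (-a) = f := by
    have := flip (by linarith) (normSlash_inv h hi)
    simpa using this
  have T1 : normSlash m f 1 1 0 1 = f := by simpa using hT 1
  have T1' : normSlash m f 1 (-1) 0 1 = f := by simpa using hT (-1)
  have j1 : normSlash m f (-1) 0 13 (-1) = f := flipInv (by norm_num) iV
  have j2 : normSlash m f (-7) 1 13 (-2) = f := by simpa using flip (by norm_num) i2
  have j3 : normSlash m f (-2) 1 13 (-7) = f := flipInv (by norm_num) i1
  have j4 : normSlash m f 2 1 13 7 = f := by simpa using normSlash_inv (by norm_num) i2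
  have j5 : normSlash m f 4 (-1) 13 (-3) = f := by simpa using flip (by norm_num) iA'
  have j6 : normSlash m f 3 (-1) 13 (-4) = f := by simpa using normSlash_inv (by norm_num) iA'
  have j7 : normSlash m f (-3) (-1) 13 4 = f := by simpa using flipInv (by norm_num) iA
  have iγ : normSlash m f (-6) (-1) 13 2 = f :=
    (normSlash_of_invariant 1 T1' (a' := 7) (b' := 1) (c' := 13) (d' := 2)).trans i1
  have iγ' : normSlash m f (-6) 1 (-13) 2 = f :=
    (normSlash_of_invariant 1 T1 (a' := 7) (b' := -1) (c' := -13) (d' := 2)).trans i2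
  -- The classes ±5 are not reached by the matrices found so far, their inverses or sign changes;
  -- they need a product of two.
  have j8 : normSlash m f (-5) (-2) 13 5 = f :=
    (normSlash_of_invariant (-1) iγ (a' := -3) (b' := -1) (c' := 13) (d' := 4)).trans j7
  have j9 : normSlash m f 5 (-2) 13 (-5) = f :=
    (normSlash_of_invariant (-1) iγ' (a' := 3) (b' := -1) (c' := 13) (d' := -4)).trans j6
  have hx' : x % 13 = 1 ∨ x % 13 = 2 ∨ x % 13 = 3 ∨ x % 13 = 4 ∨ x % 13 = 5 ∨ x % 13 = 6 ∨
      x % 13 = 7 ∨ x % 13 = 8 ∨ x % 13 = 9 ∨ x % 13 = 10 ∨ x % 13 = 11 ∨ x % 13 = 12 := by omega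
  rcases hx' with h | h | h | h | h | h | h | h | h | h | h | h
  · exact ⟨1, 0, 1, by omega, by norm_num, by exact_mod_cast iV⟩
  · exact ⟨2, 1, 7, by omega, by norm_num, by exact_mod_cast j4⟩
  · exact ⟨3, -1, -4, by omega, by norm_num, by exact_mod_cast j6⟩
  · exact ⟨4, -1, -3, by omega, by norm_num, by exact_mod_cast j5⟩
  · exact ⟨5, -2, -5, by omega, by norm_num, by exact_mod_cast j9⟩
  · exact ⟨-7, 1, -2, by omega, by norm_num, by exact_mod_cast j2⟩
  · exact ⟨7, 1, 2, by omega, by norm_num, by exact_mod_cast i1⟩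
  · exact ⟨-5, -2, 5, by omega, by norm_num, by exact_mod_cast j8⟩
  · exact ⟨-4, -1, 3, by omega, by norm_num, by exact_mod_cast iA⟩
  · exact ⟨-3, -1, 4, by omega, by norm_num, by exact_mod_cast j7⟩
  · exact ⟨-2, 1, -7, by omega, by norm_num, by exact_mod_cast j3⟩
  · exact ⟨-1, 0, -1, by omega, by norm_num, by exact_mod_cast j1⟩

/-- Invariance under translations and under enough matrices with lower left entry 13 implies
invariance under `Γ₀(13)`. -/
lemma gamma0_thirteen_invariant (hT : ∀ n : ℤ, normSlash m f 1 n 0 1 = f)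
    (hG : ∀ x : ℤ, ¬ (13 : ℤ) ∣ x → ∃ x₀ y w : ℤ, (13 : ℤ) ∣ x - x₀ ∧ x₀ * w - y * 13 = 1 ∧
      normSlash m f x₀ y 13 w = f) (n : ℕ) :
    ∀ a b c d : ℤ, c.natAbs = n → a * d - b * (13 * c) = 1 →
      normSlash m f a b ((13 * c : ℤ) : ℝ) d = f := by
  induction n using Nat.strong_induction_on with
  | _ n ih =>
    intro a b c d hcn hdet
    have hdetR : (a * d - b * ((13 * c : ℤ) : ℝ) : ℝ) = 1 := by exact_mod_cast hdet
    rcases eq_or_ne c 0 with rfl | hc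
    · have had : a * d = 1 := by simpa using hdet
      rcases Int.eq_one_or_neg_one_of_mul_eq_one' had with ⟨rfl, rfl⟩ | ⟨rfl, rfl⟩
      · simpa using hT b
      · have := normSlash_scale (m := m) (f := f) (t := -1) (a := 1) (b := ((-b : ℤ) : ℝ)) (c := 0)
          (d := 1) (by norm_num) (by norm_num)
        rw [hT (-b)] at this
        simpa using this
    -- Right multiplication by (x *; 13 *) changes the lower left entry 13c to 13(cx + d). Division
    -- with remainder suggests x = -q; if 13 divides q, x is shifted by one, which still decreases
    -- |c| because r ≠ 0: otherwise 13 would divide the determinant.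
    · have hex : ∃ x : ℤ, ¬ (13 : ℤ) ∣ x ∧ (c * x + d).natAbs < c.natAbs := by
        have hr0 := Int.emod_nonneg d hc
        have hr1 := Int.emod_lt_abs d hc
        have hr2 := Int.emod_add_mul_ediv d c
        set r := d % c with hr
        set q := d / c with hq
        by_cases hdiv : (13 : ℤ) ∣ q
        · have hrne : r ≠ 0 := by
            intro hr'
            obtain ⟨q', hq'⟩ := hdiv
            have : (13 : ℤ) ∣ 1 := ⟨a * c * q' - b * c, by
              rw [← hdet, ← hr2, hr', hq']; ring⟩
            norm_num at this
          rcases lt_or_gt_of_ne hc with hneg | hpos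
          · refine ⟨-q + 1, by omega, ?_⟩
            have : c * (-q + 1) + d = r + c := by linear_combination -hr2
            rw [this]
            rw [abs_of_neg hneg] at hr1
            omega
          · refine ⟨-q - 1, by omega, ?_⟩
            have : c * (-q - 1) + d = r - c := by linear_combination -hr2
            rw [this]
            rw [abs_of_pos hpos] at hr1
            omega
        · refine ⟨-q, by omega, ?_⟩
          have : c * (-q) + d = r := by linear_combination -hr2
          rw [this]
          rw [Int.abs_eq_natAbs] at hr1
          omega
      obtain ⟨x, hx13, hxlt⟩ := hex
      obtain ⟨x₀, y, w, ⟨t, ht⟩, hdet', hinv⟩ := hG x hx13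
      have hdetR' : (x₀ * w - y * 13 : ℝ) = 1 := by exact_mod_cast hdet'
      have hinv' : normSlash m f x ((y + t * w : ℤ) : ℝ) 13 w = f := by
        have h1 : (x : ℝ) = x₀ + 13 * t := by exact_mod_cast (by linarith : x = x₀ + 13 * t)
        have := normSlash_comp (m := m) (f := f) (a := 1) (b := t) (c := 0) (d := 1) (a' := x₀)
          (b' := y) (c' := 13) (d' := w) (by norm_num) (by rw [hdetR']; norm_num)
        rw [hT t, hinv] at this
        refine Eq.trans ?_ this.symm
        rw [h1]
        push_cast
        congr 1 <;> ring
      have hdx : x * w - (y + t * w) * 13 = 1 := by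
        have : x = x₀ + 13 * t := by linarith
        rw [this]; linear_combination hdet'
      have hdxR : (x * w - ((y + t * w : ℤ) : ℝ) * 13 : ℝ) = 1 := by exact_mod_cast hdx
      have key := ih (c * x + d).natAbs (hcn ▸ hxlt) (a * x + b * 13) (a * (y + t * w) + b * w)
        (c * x + d) (13 * c * (y + t * w) + d * w) rfl (by
          linear_combination (x * w - (y + t * w) * 13) * hdet + hdx)
      apply normSlash_injective (a := x) (b := ((y + t * w : ℤ) : ℝ)) (c := 13) (d := w)
        (by rw [hdxR]; norm_num)
      rw [hinv', normSlash_comp (by rw [hdetR]; norm_num) (by rw [hdxR]; norm_num)]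
      refine Eq.trans ?_ key
      push_cast
      congr 1; ring

end Generation

end

/-! ### Vanishing at the cusps -/

noncomputable section

open UpperHalfPlane ModularForm Filter Topology

section CuspForms

variable {m : ℕ} {f : ℍ → ℂ}

lemma isZeroAtImInfty_normSlash_upper (hf : IsZeroAtImInfty f) {a b d : ℝ}
    (h : 0 < a * d - b * 0) : IsZeroAtImInfty (normSlash m f a b 0 d) := by
  have h1 : Tendsto (fun z : ℍ => realGL a b 0 d • z) atImInfty atImInfty :=
    tendsto_smul_atImInfty (by rw [coe_realGL h]; simp)
  have h2 := (Tendsto.comp hf h1).const_mul ((((a * d - b * 0 : ℝ) : ℂ) / (d : ℂ) ^ 2) ^ m)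
  rw [mul_zero ((_ : ℂ) ^ m)] at h2
  refine h2.congr fun z => ?_
  simp [normSlash]

lemma slash_mapGL_eq_normSlash (γ : SL(2, ℤ)) :
    f ∣[(2 * m : ℤ)] (Matrix.SpecialLinearGroup.mapGL ℝ γ) =
      normSlash m f (γ 0 0) (γ 0 1) (γ 1 0) (γ 1 1) := by
  rw [normSlash_eq_slash (by simp)]
  simp

lemma exists_cuspForm_gamma0_thirteen {e : ℂ} (hf : MDifferentiable 𝓘(ℂ) 𝓘(ℂ) f)
    (hzero : IsZeroAtImInfty f) (hW : normSlash m f 0 (-1) 13 0 = e • f)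
    (hΓ : ∀ a b c d : ℤ, a * d - b * (13 * c) = 1 →
      normSlash m f a b ((13 * c : ℤ) : ℝ) d = f) :
    ∃ g : CuspForm (CongruenceSubgroup.Gamma0 13 : Subgroup (GL (Fin 2) ℝ)) (2 * m : ℤ),
      (g : ℍ → ℂ) = f := by
  have hinv : ∀ γ : SL(2, ℤ), (13 : ℤ) ∣ γ 1 0 →
      f ∣[(2 * m : ℤ)] (Matrix.SpecialLinearGroup.mapGL ℝ γ) = f := by
    rintro γ ⟨c, hc⟩
    have hdet := γ.det_coe
    rw [Matrix.det_fin_two, hc] at hdet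
    rw [slash_mapGL_eq_normSlash, hc]
    exact hΓ _ _ _ _ hdet
  refine ⟨⟨⟨f, ?_⟩, hf, ?_⟩, rfl⟩
  · rintro _ ⟨γ, hγ, rfl⟩
    refine hinv γ ?_
    have : ((γ 1 0 : ℤ) : ZMod 13) = 0 := CongruenceSubgroup.Gamma0_mem.1 hγ
    exact (ZMod.intCast_zmod_eq_zero_iff_dvd _ 13).1 this
  · intro c hc
    obtain ⟨γ, rfl⟩ := isCusp_SL2Z_iff'.1
      ((Subgroup.IsArithmetic.isCusp_iff_isCusp_SL2Z _).1 hc)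
    rw [OnePoint.isZeroAt_iff rfl]
    change IsZeroAtImInfty (f ∣[(2 * m : ℤ)] (Matrix.SpecialLinearGroup.mapGL ℝ γ))
    by_cases hdvd : (13 : ℤ) ∣ γ 1 0
    · rwa [hinv γ hdvd]
    · have hcop : IsCoprime (γ 1 0) 13 :=
        ((Int.prime_iff_natAbs_prime.2 (by norm_num)).coprime_iff_not_dvd.2 hdvd).symm
      obtain ⟨u, v, huv⟩ := hcop
      have hdet := γ.det_coe
      rw [Matrix.det_fin_two] at hdet
      set a := γ 0 0
      set b := γ 0 1
      set c := γ 1 0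
      set d := γ 1 1
      -- With j = ud, γ factors as an element of Γ₀(13) times (0 -1; 1 j), and 13·(0 -1; 1 j) = W·(1
      -- j; 0 13). This moves the cusp to ∞.
      have hS : normSlash m f a b c d = e • normSlash m f 1 ((u * d : ℤ) : ℝ) 0 13 := by
        have h1 := hΓ (a * (u * d) - b) a (-v * d) c (by
          linear_combination hdet + (d * a) * huv)
        have e1 : normSlash m (normSlash m f (a * (u * d) - b : ℤ) a ((13 * (-v * d) : ℤ) : ℝ) c)
            0 (-1) 1 ((u * d : ℤ) : ℝ) = normSlash m f a b c d := by
          have hh : (((a * (u * d) - b : ℤ) : ℝ) * c - a * ((13 * (-v * d) : ℤ) : ℝ)) = 1 := by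
            have : (a * (u * d) - b) * c - a * (13 * (-v * d)) = 1 := by
              linear_combination hdet + (d * a) * huv
            exact_mod_cast this
          rw [normSlash_comp (by rw [hh]; norm_num) (by norm_num)]
          have k1 : (u * c + v * 13 : ℝ) = 1 := by exact_mod_cast huv
          push_cast
          congr 1
          · ring
          · ring
          · ring
          · linear_combination (d : ℝ) * k1
        rw [← e1, h1, ← normSlash_smul, ← hW, normSlash_comp (by norm_num) (by norm_num),
          ← normSlash_scale (t := 13) (by norm_num) (by norm_num)]
        congr 1 <;> ring
      rw [slash_mapGL_eq_normSlash, hS]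
      have := (isZeroAtImInfty_normSlash_upper (m := m) hzero (a := 1) (b := ((u * d : ℤ) : ℝ))
        (d := 13) (by norm_num)).const_mul e
      rw [mul_zero] at this
      exact this

end CuspForms

end

/-! ### From the Euler factors to coefficient relations -/

noncomputable section

open Filter Topology

section Coefficients

/-- The terms of a convergent series tend to 0, hence are bounded. -/
lemma HasDirichletSum.exists_norm_le {a : ℕ → ℂ} {σ : ℝ} {l : ℂ} (h : HasDirichletSum a σ l) :
    ∃ C : ℝ, ∀ n : ℕ, n ≠ 0 → ‖a n‖ ≤ C * (n : ℝ) ^ σ := by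
  have h1 : Tendsto (fun N : ℕ => a (N + 1) / ((N + 1 : ℕ) : ℂ) ^ (σ : ℂ)) atTop (𝓝 0) := by
    have := ((tendsto_add_atTop_iff_nat 1).2 h).sub h
    rw [sub_self] at this
    refine this.congr fun N => ?_
    rw [Finset.sum_Icc_succ_top (by omega)]
    simp
  obtain ⟨C, hC⟩ := (Metric.isBounded_range_of_tendsto _ h1).exists_norm_le
  refine ⟨C, fun n hn => ?_⟩
  obtain ⟨N, rfl⟩ := Nat.exists_eq_succ_of_ne_zero hn
  have := hC _ ⟨N, rfl⟩
  have hpos : (0 : ℝ) < ((N + 1 : ℕ) : ℝ) := by positivity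
  rw [norm_div, Complex.norm_natCast_cpow_of_pos (by omega), Complex.ofReal_re,
    div_le_iff₀ (Real.rpow_pos_of_pos hpos _)] at this
  exact this

lemma HasDirichletSum.lseriesHasSum {a : ℕ → ℂ} {s l : ℂ} (h : HasDirichletSum a s l)
    (hs : LSeriesSummable a s) : LSeriesHasSum a s l := by
  have h1 : Tendsto (fun N : ℕ => ∑ n ∈ Finset.range (N + 1), LSeries.term a s n) atTop
      (𝓝 (LSeries a s)) := (tendsto_add_atTop_iff_nat 1).2 hs.hasSum.tendsto_sum_nat
  have h2 : l = LSeries a s := by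
    refine tendsto_nhds_unique h (h1.congr fun N => ?_)
    rw [Finset.range_eq_Ico, Finset.sum_eq_sum_Ico_succ_bot (by omega), LSeries.term_zero, zero_add]
    refine Finset.sum_congr (by ext; simp [Nat.succ_le_iff]) fun n hn => ?_
    rw [LSeries.term_of_ne_zero (by have := Finset.mem_Icc.1 hn; omega)]
  rw [h2]
  exact hs.LSeriesHasSum

/-- The sequence supported on the multiples of `p` with value `u (n / p)` there. -/
def dilate (p : ℕ) (u : ℕ → ℂ) (n : ℕ) : ℂ := if p ∣ n then u (n / p) else 0

lemma dilate_mul {p : ℕ} (hp : 0 < p) (u : ℕ → ℂ) (n : ℕ) : dilate p u (p * n) = u n := by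
  rw [dilate, if_pos (dvd_mul_right _ _), Nat.mul_div_cancel_left _ hp]

lemma LSeriesHasSum.dilate {u : ℕ → ℂ} {s l : ℂ} (h : LSeriesHasSum u s l) {p : ℕ} (hp : 0 < p) :
    LSeriesHasSum (dilate p u) s (l / (p : ℂ) ^ s) := by
  have hinj : Function.Injective (fun n : ℕ => p * n) := fun _ _ h =>
    Nat.eq_of_mul_eq_mul_left hp h
  rw [LSeriesHasSum, ← hinj.hasSum_iff]
  · refine (HasSum.div_const h ((p : ℂ) ^ s)).congr_fun ?_
    intro n
    rcases eq_or_ne n 0 with rfl | hn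
    · simp
    · rw [Function.comp_apply, LSeries.term_of_ne_zero hn,
        LSeries.term_of_ne_zero (Nat.mul_ne_zero hp.ne' hn), dilate_mul hp, Nat.cast_mul,
        Complex.natCast_mul_natCast_cpow, div_div, mul_comm]
  · intro n hn
    have : ¬ p ∣ n := fun ⟨k, hk⟩ => hn ⟨k, hk.symm⟩
    simp [LSeries.term_def, _root_.dilate, this]

/-- Multiplication by an Euler factor of degree two, on coefficients. -/
def eulerMul (p : ℕ) (α β : ℂ) (u : ℕ → ℂ) : ℕ → ℂ :=
  u - α • dilate p u + β • dilate p (dilate p u)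

lemma LSeriesHasSum.eulerMul {u : ℕ → ℂ} {s l : ℂ} (h : LSeriesHasSum u s l) {p : ℕ} (hp : 0 < p)
    (α β : ℂ) : LSeriesHasSum (eulerMul p α β u) s
      (l * (1 - α / (p : ℂ) ^ s + β / (p : ℂ) ^ (2 * s))) := by
  have h1 := h.dilate hp
  have h2 := h1.dilate hp
  have h3 : l * (1 - α / (p : ℂ) ^ s + β / (p : ℂ) ^ (2 * s)) =
      l - α * (l / (p : ℂ) ^ s) + β * (l / (p : ℂ) ^ s / (p : ℂ) ^ s) := by
    rw [show 2 * s = s + s by ring, Complex.cpow_add _ _ (by exact_mod_cast hp.ne'), div_div]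
    ring
  rw [h3]
  exact (h.sub (h1.smul α)).add (h2.smul β)

/-- If multiplying `u` by an Euler factor at `q` kills the coefficients divisible by `p`, then so
are those of `u` themselves. -/
lemma eq_zero_of_eulerMul {p q : ℕ} (hpq : p.Coprime q) (hq : 1 < q) {α β : ℂ}
    {u v : ℕ → ℂ} (huv : ∀ n, n ≠ 0 → eulerMul q α β u n = v n)
    (hv : ∀ n, n ≠ 0 → p ∣ n → v n = 0) (n : ℕ) : n ≠ 0 → p ∣ n → u n = 0 := by
  induction n using Nat.strong_induction_on with
  | _ n ih =>
    intro hn hp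
    have h1 := huv n hn
    rw [hv n hn hp] at h1
    simp only [eulerMul, Pi.add_apply, Pi.sub_apply, Pi.smul_apply, smul_eq_mul] at h1
    have hd : ∀ k, k ≠ 0 → k ≤ n → p ∣ k → dilate q u k = 0 := by
      intro k hk hkn hpk
      rw [dilate]
      split_ifs with hqk
      · obtain ⟨j, rfl⟩ := hqk
        rw [Nat.mul_div_cancel_left _ (by omega)]
        have hj : j ≠ 0 := by rintro rfl; simp at hk
        exact ih j (by nlinarith [Nat.pos_of_ne_zero hj]) hj (hpq.dvd_of_dvd_mul_left hpk)
      · rfl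
    have hdd : dilate q (dilate q u) n = 0 := by
      rw [dilate]
      split_ifs with hqn
      · obtain ⟨j, rfl⟩ := hqn
        rw [Nat.mul_div_cancel_left _ (by omega)]
        have hj : j ≠ 0 := by rintro rfl; simp at hn
        exact hd j hj (by nlinarith) (hpq.dvd_of_dvd_mul_left hp)
      · rfl
    rw [hd n hn le_rfl hp, hdd] at h1
    simpa using h1

lemma eventually_eulerFactor_ne_zero {p : ℕ} (hp : 1 < p) (α β : ℂ) :
    ∀ᶠ x : ℝ in atTop, (1 - α / (p : ℂ) ^ (x : ℂ) + β / (p : ℂ) ^ (2 * (x : ℂ))) ≠ 0 := by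
  have hp1 : (1 : ℝ) < p := by exact_mod_cast hp
  have key : ∀ γ : ℂ, Tendsto (fun x : ℝ => γ / (p : ℂ) ^ (x : ℂ)) atTop (𝓝 0) := by
    intro γ
    rw [tendsto_zero_iff_norm_tendsto_zero]
    have : Tendsto (fun x : ℝ => ‖γ‖ / (p : ℝ) ^ x) atTop (𝓝 0) :=
      (tendsto_rpow_atTop_of_base_gt_one _ hp1).const_div_atTop _
    refine this.congr fun x => ?_
    rw [norm_div, Complex.norm_natCast_cpow_of_pos (by omega), Complex.ofReal_re]
  have k2 : Tendsto (fun x : ℝ => β / (p : ℂ) ^ (2 * (x : ℂ))) atTop (𝓝 0) := by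
    have := (key β).comp (tendsto_id.const_mul_atTop (show (0 : ℝ) < 2 by norm_num))
    refine this.congr fun x => ?_
    simp
  have h := ((tendsto_const_nhds (x := (1 : ℂ))).sub (key α)).add k2
  rw [sub_zero, add_zero] at h
  exact h.eventually_ne one_ne_zero

/-- The Hecke relations at a prime `p` encoded by Euler factors at `p` and `q`. -/
lemma hecke_coefficients {a b : ℕ → ℂ} {p q : ℕ} (hp : 1 < p) (hq : 1 < q) (hpq : p.Coprime q)
    {α β α' β' : ℂ} {L M : ℂ → ℂ} {c : ℝ}
    (hL : ∀ s : ℂ, c < s.re → LSeriesHasSum a s (L s))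
    (hM : ∀ s : ℂ, c < s.re → LSeriesHasSum b s (M s))
    (hE : ∀ s : ℂ, c < s.re → L s = (1 - α / (p : ℂ) ^ s + β / (p : ℂ) ^ (2 * s))⁻¹
      * (1 - α' / (q : ℂ) ^ s + β' / (q : ℂ) ^ (2 * s))⁻¹ * M s)
    (hb : ∀ n, n ≠ 0 → p ∣ n → b n = 0) (n : ℕ) (hn : n ≠ 0) :
    a (p * n) = α * a n - β * dilate p a n := by
  have hsum : ∀ s : ℂ, c < s.re → LSeriesHasSum (eulerMul q α' β' (eulerMul p α β a)) s
      (L s * (1 - α / (p : ℂ) ^ s + β / (p : ℂ) ^ (2 * s)) *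
        (1 - α' / (q : ℂ) ^ s + β' / (q : ℂ) ^ (2 * s))) := fun s hs =>
    ((hL s hs).eulerMul (by omega) α β).eulerMul (by omega) α' β'
  have habs : ∀ {u : ℕ → ℂ} {w : ℂ}, LSeriesHasSum u (c + 1 : ℝ) w →
      LSeries.abscissaOfAbsConv u < ⊤ := fun hu =>
    (LSeriesHasSum.LSeriesSummable hu).abscissaOfAbsConv_le.trans_lt (EReal.coe_lt_top _)
  have hc1 : c < ((c + 1 : ℝ) : ℂ).re := by rw [Complex.ofReal_re]; linarith
  -- For large real s both Euler factors are nonzero, so the inverses in `hE` cancel; a Dirichlet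
  -- series then determines its coefficients.
  have huv : ∀ n, n ≠ 0 → eulerMul q α' β' (eulerMul p α β a) n = b n := by
    intro n hn
    refine LSeries.eq_of_LSeries_eventually_eq (habs (hsum _ hc1)) (habs (hM _ hc1)) ?_ hn
    filter_upwards [eventually_eulerFactor_ne_zero hp α β, eventually_eulerFactor_ne_zero hq α' β',
      eventually_gt_atTop c] with x hx1 hx2 hxc
    have hxc' : c < (x : ℂ).re := by simpa using hxc
    rw [(hsum x hxc').LSeries_eq, (hM x hxc').LSeries_eq, hE x hxc']
    field_simp
  -- Stripping the factor at q leaves `eulerMul p α β a` zero at pn, which is the Hecke relation.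
  have h0 := eq_zero_of_eulerMul hpq hq huv hb (p * n) (Nat.mul_ne_zero (by omega) hn)
    (dvd_mul_right _ _)
  simp only [eulerMul, Pi.add_apply, Pi.sub_apply, Pi.smul_apply, smul_eq_mul,
    dilate_mul (show 0 < p by omega)] at h0
  linear_combination h0

end Coefficients

end

/-! ### Hecke operators on Fourier series -/

noncomputable section

open UpperHalfPlane Filter Topology

section HeckeOperators

/-- The additive character `e(z) = exp(2πiz)`. -/
def addExp (z : ℂ) : ℂ := Complex.exp (2 * Real.pi * Complex.I * z)

lemma addExp_add (z w : ℂ) : addExp (z + w) = addExp z * addExp w := by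
  rw [addExp, addExp, addExp, ← Complex.exp_add]
  ring_nf

lemma addExp_int (n : ℤ) : addExp n = 1 := by
  rw [addExp, Complex.exp_eq_one_iff]
  exact ⟨n, by ring⟩

lemma addExp_nat_mul (n : ℕ) (z : ℂ) : addExp (n * z) = addExp z ^ n := by
  rw [addExp, addExp, ← Complex.exp_nat_mul]
  ring_nf

lemma sum_addExp_div {p : ℕ} (hp : 0 < p) (n : ℕ) :
    ∑ j ∈ Finset.range p, addExp (n * (j / p)) = if p ∣ n then (p : ℂ) else 0 := by
  have hp0 : (p : ℂ) ≠ 0 := by exact_mod_cast hp.ne'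
  have h1 : ∀ j : ℕ, addExp (n * (j / p)) = addExp (n / p) ^ j := by
    intro j
    rw [← addExp_nat_mul]
    congr 1
    ring
  simp only [h1]
  split_ifs with h
  · obtain ⟨k, rfl⟩ := h
    have : addExp (((p * k : ℕ) : ℂ) / p) = 1 := by
      rw [Nat.cast_mul, mul_div_cancel_left₀ _ hp0]
      exact_mod_cast addExp_int k
    simp only [this, one_pow]
    simp
  · have hne : addExp (n / p) ≠ 1 := by
      intro h1
      rw [addExp, Complex.exp_eq_one_iff] at h1
      obtain ⟨k, hk⟩ := h1
      have h2 : (n : ℂ) / p = k := by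
        have : (2 * Real.pi * Complex.I : ℂ) ≠ 0 := Complex.two_pi_I_ne_zero
        apply mul_left_cancel₀ this
        rw [hk]; ring
      rw [div_eq_iff hp0] at h2
      have h3 : (n : ℤ) = k * p := by exact_mod_cast h2
      exact h (Int.natCast_dvd_natCast.1 ⟨k, by rw [h3]; ring⟩)
    rw [geom_sum_eq hne, ← addExp_nat_mul, mul_div_cancel₀ _ hp0]
    have : addExp (n : ℂ) = 1 := by exact_mod_cast addExp_int n
    rw [this]
    simp

variable {a : ℕ → ℂ} {f : ℍ → ℂ}

lemma fourier_hasSum_nat (ha : a 0 = 0)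
    (hf : ∀ z : ℍ, HasSum (fun n : ℕ+ => a n *
      Complex.exp (2 * Real.pi * Complex.I * (n * (z : ℂ)))) (f z)) (z : ℍ) :
    HasSum (fun n : ℕ => a n * addExp (n * z)) (f z) := by
  have h1 : Function.Injective (fun n : ℕ+ => (n : ℕ)) := PNat.coe_injective
  rw [← h1.hasSum_iff]
  · exact hf z
  · intro n hn
    have : n = 0 := by
      by_contra h
      exact hn ⟨⟨n, Nat.pos_of_ne_zero h⟩, rfl⟩
    simp [this, ha]

lemma normSlash_translate {m : ℕ}
    (hf : ∀ z : ℍ, HasSum (fun n : ℕ => a n * addExp (n * z)) (f z)) (n : ℤ) :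
    normSlash m f 1 n 0 1 = f := by
  funext z
  have hz : ((realGL 1 n 0 1 • z : ℍ) : ℂ) = z + n := by
    rw [coe_realGL_smul (by norm_num)]; simp
  have h1 := hf (realGL 1 n 0 1 • z)
  rw [hz] at h1
  have h2 : f (realGL 1 n 0 1 • z) = f z := by
    refine h1.unique ((hf z).congr_fun fun k => ?_)
    rw [mul_add, addExp_add, show ((k : ℂ) * (n : ℂ)) = ((k * n : ℤ) : ℂ) by push_cast; rfl,
      addExp_int, mul_one]
  simp [normSlash, h2]

/-- The Hecke relations for the coefficients make `f` an eigenfunction of the Hecke operator. -/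
lemma normSlash_hecke {m p : ℕ} (hm : 0 < m) (hp : 0 < p) (ha : a 0 = 0)
    (hf : ∀ z : ℍ, HasSum (fun n : ℕ => a n * addExp (n * z)) (f z)) {α : ℂ}
    (hrel : ∀ n, n ≠ 0 → a (p * n) = α * a n - (p : ℂ) ^ (2 * m - 1) * dilate p a n) :
    normSlash m f p 0 0 1 + ∑ j ∈ Finset.range p, normSlash m f 1 j 0 p =
      (α * p / (p : ℂ) ^ m) • f := by
  have hp0 : (p : ℂ) ≠ 0 := by exact_mod_cast hp.ne'
  have hpR : (0 : ℝ) < p := by exact_mod_cast hp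
  have hinj : Function.Injective (fun n : ℕ => p * n) := fun _ _ h =>
    Nat.eq_of_mul_eq_mul_left hp h
  funext z
  have hz1 : ((realGL p 0 0 1 • z : ℍ) : ℂ) = p * z := by
    rw [coe_realGL_smul (by simpa using hpR)]; simp
  have hz2 : ∀ j : ℕ, ((realGL 1 j 0 p • z : ℍ) : ℂ) = (z + j) / p := by
    intro j
    rw [coe_realGL_smul (by simpa using hpR)]; simp
  have s1 : HasSum (fun n : ℕ => dilate p a n * addExp (n * z)) (f (realGL p 0 0 1 • z)) := by
    rw [← hinj.hasSum_iff]
    · have := hf (realGL p 0 0 1 • z)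
      rw [hz1] at this
      refine this.congr_fun fun n => ?_
      rw [Function.comp_apply, dilate_mul hp]
      push_cast
      ring_nf
    · intro n hn
      have : ¬ p ∣ n := fun ⟨k, hk⟩ => hn ⟨k, hk.symm⟩
      simp [dilate, this]
  -- Orthogonality of the characters j ↦ e(nj/p) retains only the indices divisible by p.
  have s2 : HasSum (fun n : ℕ => (p : ℂ) * (a (p * n) * addExp (n * z)))
      (∑ j ∈ Finset.range p, f (realGL 1 j 0 p • z)) := by
    have h1 : HasSum (fun n : ℕ => ∑ j ∈ Finset.range p, a n * addExp (n * ((z + j) / p)))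
        (∑ j ∈ Finset.range p, f (realGL 1 j 0 p • z)) := by
      refine hasSum_sum fun j _ => ?_
      have := hf (realGL 1 j 0 p • z)
      rwa [hz2] at this
    have h2 : ∀ n : ℕ, ∑ j ∈ Finset.range p, a n * addExp (n * ((z + j) / p)) =
        a n * addExp (n * (z / p)) * (if p ∣ n then (p : ℂ) else 0) := by
      intro n
      rw [← sum_addExp_div hp n, Finset.mul_sum]
      refine Finset.sum_congr rfl fun j _ => ?_
      rw [add_div, mul_add, addExp_add, mul_assoc]
    simp only [h2] at h1
    rw [← hinj.hasSum_iff] at h1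
    · refine h1.congr_fun fun n => ?_
      rw [Function.comp_apply, if_pos (dvd_mul_right _ _), Nat.cast_mul,
        show (p * n : ℂ) * (z / p) = n * z by field_simp]
      ring
    · intro n hn
      have : ¬ p ∣ n := fun ⟨k, hk⟩ => hn ⟨k, hk.symm⟩
      simp [this]
  have s3 : ∑ j ∈ Finset.range p, f (realGL 1 j 0 p • z) =
      p * (α * f z - (p : ℂ) ^ (2 * m - 1) * f (realGL p 0 0 1 • z)) := by
    refine s2.unique (((((hf z).mul_left α).sub (s1.mul_left ((p : ℂ) ^ (2 * m - 1)))).mul_left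
      (p : ℂ)).congr_fun fun n => ?_)
    rcases eq_or_ne n 0 with rfl | hn
    · simp [ha, dilate]
    · rw [hrel n hn]
      ring
  have hpow : (p : ℂ) * (p : ℂ) ^ (2 * m - 1) = (p : ℂ) ^ m * (p : ℂ) ^ m := by
    rw [← pow_succ', ← pow_add]
    congr 1
    omega
  generalize (p : ℂ) ^ (2 * m - 1) = P at s3 hpow
  simp only [Pi.add_apply, Finset.sum_apply, Pi.smul_apply, smul_eq_mul, normSlash]
  push_cast
  simp only [zero_mul, mul_zero, mul_one, sub_zero, zero_add, one_mul, one_pow, div_one]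
  rw [← Finset.mul_sum, s3, div_pow, ← pow_mul, mul_comm 2 m, pow_mul]
  field_simp
  linear_combination (-f (realGL p 0 0 1 • z)) * hpow

end HeckeOperators

end

/-! ### Mellin transforms and the functional equation -/

noncomputable section

open Filter Topology Set MeasureTheory Asymptotics

section MellinFunctionalEquation

lemma LocallyIntegrableOn.indicator_set {F : ℝ → ℂ} {s S : Set ℝ} (hS : MeasurableSet S)
    (hF : LocallyIntegrableOn F s) : LocallyIntegrableOn (S.indicator F) s := fun x hx =>
  let ⟨t, ht, hi⟩ := hF x hx
  ⟨t, ht, Integrable.indicator hi hS⟩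

lemma norm_mellin_le_of_rpow_le {F : ℝ → ℂ} {s : ℂ} {σ : ℝ} (hF : MellinConvergent F σ)
    (h : ∀ t : ℝ, 0 < t → F t ≠ 0 → t ^ (s.re - 1) ≤ t ^ (σ - 1)) :
    ‖mellin F s‖ ≤ ∫ t in Ioi (0 : ℝ), ‖(t : ℂ) ^ ((σ : ℂ) - 1) • F t‖ := by
  refine norm_integral_le_of_norm_le hF.norm ?_
  filter_upwards [ae_restrict_mem measurableSet_Ioi] with t ht
  have ht' : (0 : ℝ) < t := ht
  rw [norm_smul, norm_smul, Complex.norm_cpow_eq_rpow_re_of_pos ht',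
    Complex.norm_cpow_eq_rpow_re_of_pos ht']
  simp only [Complex.sub_re, Complex.one_re, Complex.ofReal_re]
  by_cases h0 : F t = 0
  · simp [h0]
  · exact mul_le_mul_of_nonneg_right (h t ht' h0) (norm_nonneg _)

/-- If the Mellin transform of `F` continues to an entire function which is bounded in vertical
strips and satisfies a functional equation, then `F` is symmetric under `t ↦ 1 / t`. -/
theorem inversion_of_mellin_functional_equation {F : ℝ → ℂ} (hFc : ContinuousOn F (Ioi 0))
    {A b : ℝ} (hA : 0 < A) (hF_top : F =O[atTop] fun t => Real.exp (-A * t))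
    (hF_bot : F =O[𝓝[>] 0] (· ^ (-b))) {Λ : ℂ → ℂ} (hΛ : Differentiable ℂ Λ)
    (hΛb : BoundedInVerticalStrips Λ) {c : ℝ} (hFΛ : ∀ s : ℂ, c < s.re → mellin F s = Λ s)
    {k : ℕ} {ε : ℂ} (hε : ε * ε = 1) (hFE : ∀ s, Λ s = ε * Λ (k - s)) {t : ℝ} (ht0 : 0 < t)
    (ht1 : t < 1) : F t = ε * (t : ℂ) ^ (-(k : ℂ)) * F t⁻¹ := by
  -- G is the part of F beyond 1, K its reflection to t < 1, and D = F - G - εK is supported in (0,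
  -- 1]. The claim is that D vanishes on (0, 1).
  set G : ℝ → ℂ := (Ioi (1 : ℝ)).indicator F with hG
  set K : ℝ → ℂ := fun t => (t : ℂ) ^ (-(k : ℂ)) • G t⁻¹ with hK
  set D : ℝ → ℂ := fun t => F t - G t - ε • K t with hD
  have hGpos : ∀ {t : ℝ}, 1 < t → G t = F t := fun h => indicator_of_mem h _
  have hGneg : ∀ {t : ℝ}, t ≤ 1 → G t = 0 := fun h => indicator_of_notMem (by simpa using h) _
  -- local integrability
  have hFl : LocallyIntegrableOn F (Ioi 0) := hFc.locallyIntegrableOn measurableSet_Ioi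
  have hGl : LocallyIntegrableOn G (Ioi 0) := LocallyIntegrableOn.indicator_set measurableSet_Ioi hFl
  have hFinv : ContinuousOn (fun t : ℝ => (t : ℂ) ^ (-(k : ℂ)) • F t⁻¹) (Ioi 0) := by
    have h1 : ContinuousOn (fun t : ℝ => F t⁻¹) (Ioi 0) :=
      hFc.comp (continuousOn_inv₀.mono fun t ht => ne_of_gt ht)
        fun t ht => mem_Ioi.2 (inv_pos.2 (mem_Ioi.1 ht))
    have h2 : ContinuousOn (fun t : ℝ => (t : ℂ) ^ (-(k : ℂ))) (Ioi 0) := fun t ht =>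
      (Complex.continuousAt_ofReal_cpow_const t _ (Or.inr (ne_of_gt ht))).continuousWithinAt
    exact h2.smul h1
  have hKeq : EqOn ((Iio (1 : ℝ)).indicator fun t : ℝ => (t : ℂ) ^ (-(k : ℂ)) • F t⁻¹) K
      (Ioi 0) := by
    intro t ht
    by_cases h : t < 1
    · rw [indicator_of_mem (show t ∈ Iio 1 from h), hK]
      simp only
      rw [hGpos ((one_lt_inv₀ ht).2 h)]
    · rw [indicator_of_notMem (by simpa using h), hK]
      simp only
      rw [hGneg (inv_le_one_of_one_le₀ (not_lt.1 h)), smul_zero]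
  have hKl : LocallyIntegrableOn K (Ioi 0) :=
    (LocallyIntegrableOn.indicator_set measurableSet_Iio
      (hFinv.locallyIntegrableOn measurableSet_Ioi)).congr
      ((ae_restrict_iff' measurableSet_Ioi).2 (.of_forall hKeq))
  have hDl : LocallyIntegrableOn D (Ioi 0) := (hFl.sub hGl).sub (hKl.smul ε)
  -- growth
  have hG_top : G =O[atTop] fun t => Real.exp (-A * t) :=
    hF_top.congr' ((eventually_gt_atTop 1).mono fun t ht => (hGpos ht).symm) .rfl
  have hG_bot : ∀ r : ℝ, G =O[𝓝[>] 0] (· ^ r) := fun r => by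
    refine (isBigO_zero (E' := ℂ) (fun t : ℝ => t ^ r) _).congr' ?_ .rfl
    filter_upwards [nhdsWithin_le_nhds (Iio_mem_nhds (show (0 : ℝ) < 1 by norm_num))] with t ht
    exact (hGneg (le_of_lt ht)).symm
  have hD_top : ∀ r : ℝ, D =O[atTop] (· ^ r) := fun r => by
    refine (isBigO_zero (E' := ℂ) (fun t : ℝ => t ^ r) _).congr' ?_ .rfl
    filter_upwards [eventually_gt_atTop 1] with t ht
    rw [hD, hK]
    simp only
    rw [hGpos ht, hGneg (inv_le_one_of_one_le₀ ht.le)]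
    simp
  have hmono : ∀ {r r' : ℝ}, r ≤ r' → (fun t : ℝ => t ^ (-r)) =O[𝓝[>] 0] fun t => t ^ (-r') := by
    intro r r' hr
    refine IsBigO.of_bound 1 ?_
    filter_upwards [self_mem_nhdsWithin,
      nhdsWithin_le_nhds (Iio_mem_nhds (show (0 : ℝ) < 1 by norm_num))] with t ht ht1
    have ht' : (0 : ℝ) < t := ht
    rw [Real.norm_of_nonneg (Real.rpow_nonneg ht'.le _),
      Real.norm_of_nonneg (Real.rpow_nonneg ht'.le _), one_mul]
    exact Real.rpow_le_rpow_of_exponent_ge ht' (le_of_lt ht1) (by linarith)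
  have hK_bot : K =O[𝓝[>] 0] fun t => t ^ (-(k : ℝ)) := by
    have h1 : (fun t : ℝ => G t⁻¹) =O[𝓝[>] 0] fun _ => (1 : ℝ) := by
      have h2 : G =O[atTop] fun _ => (1 : ℝ) := by
        refine hG_top.trans (IsBigO.of_bound 1 ?_)
        filter_upwards [eventually_ge_atTop 0] with t ht
        rw [Real.norm_of_nonneg (Real.exp_nonneg _), norm_one, mul_one, Real.exp_le_one_iff]
        nlinarith
      exact h2.comp_tendsto tendsto_inv_nhdsGT_zero
    have h3 : (fun t : ℝ => (t : ℂ) ^ (-(k : ℂ))) =O[𝓝[>] 0] fun t => t ^ (-(k : ℝ)) := by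
      refine IsBigO.of_bound 1 ?_
      filter_upwards [self_mem_nhdsWithin] with t ht
      rw [Complex.norm_cpow_eq_rpow_re_of_pos ht]
      rw [one_mul, Real.norm_of_nonneg (Real.rpow_nonneg (le_of_lt ht) _)]
      refine le_of_eq (congrArg _ ?_)
      simp
    have h4 := h3.smul h1
    simp only [smul_eq_mul, mul_one] at h4
    exact h4
  set B : ℝ := max b k with hB
  have hD_bot : D =O[𝓝[>] 0] (· ^ (-B)) :=
    ((hF_bot.trans (hmono (le_max_left _ _))).sub (hG_bot _)).sub
      ((hK_bot.trans (hmono (le_max_right _ _))).const_smul_left ε)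
  -- Mellin transforms
  have hGconv : ∀ s, MellinConvergent G s := fun s =>
    mellinConvergent_of_isBigO_rpow_exp hA hGl hG_top (hG_bot (-(s.re - 1))) (by linarith)
  have hGdiff : Differentiable ℂ (mellin G) := fun s =>
    mellin_differentiableAt_of_isBigO_rpow_exp hA hGl hG_top (hG_bot (-(s.re - 1))) (by linarith)
  have hDconv : ∀ s : ℂ, B < s.re → MellinConvergent D s := fun s hs =>
    mellinConvergent_of_isBigO_rpow hDl (hD_top (-(s.re + 1))) (by linarith) hD_bot hs
  have hKmel : ∀ s, HasMellin K s (mellin G (k - s)) := by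
    intro s
    constructor
    · rw [hK, MellinConvergent.cpow_smul]
      have := (MellinConvergent.comp_rpow (f := G) (s := s + -k) (a := -1) (by norm_num)).2
        (hGconv _)
      simpa only [Real.rpow_neg_one] using this
    · rw [hK, mellin_cpow_smul, mellin_comp_inv]
      congr 1
      ring
  have hDmel : ∀ s : ℂ, max c B < s.re →
      mellin D s = Λ s - mellin G s - ε * mellin G (k - s) := by
    intro s hs
    have hFs : MellinConvergent F s := mellinConvergent_of_isBigO_rpow_exp hA hFl hF_top hF_bot
      (lt_of_le_of_lt ((le_max_left b k).trans (le_max_right c B)) hs)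
    have h1 := hasMellin_sub hFs (hGconv s)
    have h2 := hasMellin_const_smul (hKmel s).1 ε
    have h3 := hasMellin_sub h1.1 h2.1
    rw [hD]
    rw [h3.2, h1.2, h2.2, (hKmel s).2, hFΛ s (lt_of_le_of_lt (le_max_left _ _) hs), smul_eq_mul]
  -- the entire function `R`
  set R : ℂ → ℂ := fun s => Λ s - mellin G s - ε * mellin G (k - s) with hR
  have hRdiff : Differentiable ℂ R :=
    (hΛ.sub hGdiff).sub ((hGdiff.comp (differentiable_const (k : ℂ) |>.sub differentiable_id)).const_mul ε)
  have hRsymm : ∀ s, R (k - s) = ε * R s := by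
    intro s
    simp only [hR]
    rw [sub_sub_cancel, hFE s]
    linear_combination (-Λ (k - s) + mellin G (k - s)) * hε
  have hε1 : ‖ε‖ = 1 := by
    have : ‖ε‖ * ‖ε‖ = 1 := by rw [← norm_mul, hε, norm_one]
    nlinarith [norm_nonneg ε]
  set σ : ℝ := max c B + 1 with hσ
  have hDσ : MellinConvergent D σ := hDconv _ (by
    rw [Complex.ofReal_re]; linarith [le_max_right c B])
  have hright : ∀ s : ℂ, σ ≤ s.re →
      ‖R s‖ ≤ ∫ t in Ioi (0 : ℝ), ‖(t : ℂ) ^ ((σ : ℂ) - 1) • D t‖ := by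
    intro s hs
    rw [hR]
    simp only
    rw [← hDmel s (by linarith)]
    refine norm_mellin_le_of_rpow_le hDσ fun t ht hDt => ?_
    have ht1 : t ≤ 1 := by
      by_contra h
      rw [not_le] at h
      apply hDt
      simp only [hD, hK]
      rw [hGpos h, hGneg (inv_le_one_of_one_le₀ h.le)]
      simp
    exact Real.rpow_le_rpow_of_exponent_ge ht ht1 (by linarith)
  have hGbdd : ∀ x : ℝ, ∃ C, ∀ s : ℂ, s.re ≤ x → ‖mellin G s‖ ≤ C := fun x =>
    ⟨_, fun s hs => norm_mellin_le_of_rpow_le (hGconv x) fun t _ hGt => by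
      have ht1 : 1 ≤ t := by
        by_contra h
        exact hGt (hGneg (not_le.1 h).le)
      exact Real.rpow_le_rpow_of_exponent_le ht1 (by linarith)⟩
  -- On the right R is the Mellin transform of D, bounded because D lives on t ≤ 1; on the left the
  -- symmetry `hRsymm` applies; in between Λ is bounded by hypothesis. Liouville then makes R
  -- constant.
  have hRbdd : Bornology.IsBounded (range R) := by
    obtain ⟨C1, hC1⟩ := hΛb (k - σ) σ
    obtain ⟨C2, hC2⟩ := hGbdd σ
    rw [isBounded_iff_forall_norm_le]
    refine ⟨max (∫ t in Ioi (0 : ℝ), ‖(t : ℂ) ^ ((σ : ℂ) - 1) • D t‖) (C1 + C2 + C2), ?_⟩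
    rintro _ ⟨s, rfl⟩
    rcases le_total σ s.re with h | h
    · exact (hright s h).trans (le_max_left _ _)
    rcases le_total s.re (k - σ) with h' | h'
    · have h1 := hright (k - s) (by simp; linarith)
      rw [hRsymm, norm_mul, hε1, one_mul] at h1
      exact h1.trans (le_max_left _ _)
    · refine le_trans ?_ (le_max_right _ _)
      have h1 := hC1 s h' h
      have h2 := hC2 s h
      have h3 := hC2 (k - s) (by simp; linarith)
      simp only [hR]
      refine (norm_sub_le _ _).trans (add_le_add ((norm_sub_le _ _).trans (add_le_add h1 h2)) ?_)
      rwa [norm_mul, hε1, one_mul]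
  have hRconst : ∀ s w, R s = R w := fun s w => hRdiff.apply_eq_apply_of_bounded hRbdd s w
  -- the derivative of the Mellin transform of `D` vanishes
  have hlog : ∀ s : ℂ, max c B < s.re → MellinConvergent (fun t => Real.log t • D t) s ∧
      mellin (fun t => Real.log t • D t) s = 0 := by
    intro s hs
    obtain ⟨h1, h2⟩ := mellin_hasDerivAt_of_isBigO_rpow hDl (hD_top (-(s.re + 1)))
      (lt_add_one _) hD_bot ((le_max_right _ _).trans_lt hs)
    refine ⟨h1, h2.unique ?_⟩
    have h3 : mellin D =ᶠ[𝓝 s] fun _ => R 0 := by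
      have : {w : ℂ | max c B < w.re} ∈ 𝓝 s :=
        (isOpen_lt continuous_const Complex.continuous_re).mem_nhds hs
      filter_upwards [this] with w hw
      rw [hDmel w hw]
      exact hRconst w 0
    exact (hasDerivAt_const s (R 0)).congr_of_eventuallyEq h3
  have hDnear : D =ᶠ[𝓝 t] fun t => F t - ε • ((t : ℂ) ^ (-(k : ℂ)) • F t⁻¹) := by
    filter_upwards [Ioo_mem_nhds ht0 ht1] with u hu
    simp only [hD, hK]
    rw [hGneg hu.2.le, hGpos ((one_lt_inv₀ hu.1).2 hu.2), sub_zero]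
  have hcont : ContinuousAt (fun t => Real.log t • D t) t := by
    refine (Real.continuousAt_log ht0.ne').smul ?_
    refine ContinuousAt.congr ?_ hDnear.symm
    exact (hFc.continuousAt (Ioi_mem_nhds ht0)).sub
      ((hFinv.continuousAt (Ioi_mem_nhds ht0)).const_smul ε)
  have hσ' : max c B < ((σ : ℝ) : ℂ).re := by rw [Complex.ofReal_re]; linarith
  have hzero : ∀ y : ℝ, mellin (fun t => Real.log t • D t) (σ + y * Complex.I) = 0 := fun y =>
    (hlog _ (by simpa using hσ')).2
  have hinv := mellinInv_mellin_eq σ (fun t => Real.log t • D t) ht0 (hlog _ hσ').1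
    (by simp only [Complex.VerticalIntegrable, hzero]; exact integrable_zero _ _ _) hcont
  rw [mellinInv] at hinv
  simp only [hzero, smul_zero, integral_zero] at hinv
  have hDt : D t = 0 := (smul_eq_zero.1 hinv.symm).resolve_left (Real.log_neg ht0 ht1).ne
  rw [hDnear.eq_of_nhds] at hDt
  simp only [smul_eq_mul] at hDt
  linear_combination hDt

end MellinFunctionalEquation

end

/-! ### Growth of f near ∞ and near the real axis -/

noncomputable section

open UpperHalfPlane Filter Topology Asymptotics Nat

section Growth

variable {a : ℕ → ℂ} {f : ℍ → ℂ}

lemma norm_mul_addExp (w : ℂ) (n : ℕ) (z : ℍ) :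
    ‖w * addExp (n * z)‖ = ‖w‖ * Real.exp (-(2 * Real.pi * n * z.im)) := by
  rw [norm_mul, addExp, Complex.norm_exp]
  congr 2
  simp
  ring

/-- Compare with the absolutely convergent series at height 1/2: for n, y ≥ 1 one has 2ny ≥ n + y,
so each term is at most its value there times exp(-πy). -/
lemma exists_norm_le_exp (ha : a 0 = 0)
    (hf : ∀ z : ℍ, HasSum (fun n : ℕ => a n * addExp (n * z)) (f z)) :
    ∃ K, ∀ z : ℍ, 1 ≤ z.im → ‖f z‖ ≤ K * Real.exp (-(Real.pi * z.im)) := by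
  have h1 := (hf (expI (Real.log (1 / 2)))).summable.norm
  simp_rw [norm_mul_addExp] at h1
  have him : (expI (Real.log (1 / 2))).im = 1 / 2 := by
    have : (expI (Real.log (1 / 2)) : ℂ).im = 1 / 2 := by
      rw [coe_expI, Real.exp_log (by norm_num), Complex.mul_I_im, Complex.ofReal_re]
    exact this
  rw [him] at h1
  refine ⟨_, fun z hz =>
    (hf z).norm_le_of_bounded (h1.hasSum.mul_right (Real.exp (-(Real.pi * z.im)))) fun n => ?_⟩
  rw [norm_mul_addExp]
  rcases Nat.eq_zero_or_pos n with rfl | hn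
  · simp [ha]
  have hn' : (1 : ℝ) ≤ n := by exact_mod_cast hn
  rw [mul_assoc ‖a n‖, ← Real.exp_add]
  gcongr
  nlinarith [Real.pi_pos, mul_nonneg Real.pi_pos.le
    (add_nonneg (mul_nonneg (sub_nonneg.2 hn') (zero_le_one.trans hz))
      (mul_nonneg (sub_nonneg.2 hz) (zero_le_one.trans hn')))]

lemma isZeroAtImInfty_of_hasSum (ha : a 0 = 0)
    (hf : ∀ z : ℍ, HasSum (fun n : ℕ => a n * addExp (n * z)) (f z)) : IsZeroAtImInfty f := by
  obtain ⟨K, hK⟩ := exists_norm_le_exp ha hf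
  have h1 : Tendsto (fun y : ℝ => K * Real.exp (-(Real.pi * y))) atTop (𝓝 0) := by
    rw [← mul_zero K]
    exact (Real.tendsto_exp_neg_atTop_nhds_zero.comp
      (tendsto_id.const_mul_atTop Real.pi_pos)).const_mul K
  rw [isZeroAtImInfty_iff]
  intro ε hε
  obtain ⟨A, hA⟩ := eventually_atTop.1 (h1.eventually (ge_mem_nhds hε))
  exact ⟨max A 1, fun z hz => (hK z ((le_max_right _ _).trans hz)).trans
    (hA _ ((le_max_left _ _).trans hz))⟩

/-- From eˣ ≥ xᴺ/N! with x = ny and N ≥ σ + 2, the nth term is at most a constant times n⁻²y⁻ᴺ. -/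
lemma exists_norm_le_inv_pow {C σ : ℝ} (ha : a 0 = 0)
    (hf : ∀ z : ℍ, HasSum (fun n : ℕ => a n * addExp (n * z)) (f z))
    (hC : ∀ n : ℕ, n ≠ 0 → ‖a n‖ ≤ C * (n : ℝ) ^ σ) :
    ∃ (K : ℝ) (N : ℕ), ∀ z : ℍ, ‖f z‖ ≤ K * (z.im ^ N)⁻¹ := by
  obtain ⟨N, hN⟩ := exists_nat_ge (σ + 2)
  have hC0 : 0 ≤ C := by
    have := (norm_nonneg _).trans (hC 1 one_ne_zero)
    simpa using this
  have h1 : Summable fun n : ℕ => C * N ! * (n : ℝ) ^ (-2 : ℝ) :=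
    (Real.summable_nat_rpow.2 (by norm_num)).mul_left _
  refine ⟨_, N, fun z =>
    (hf z).norm_le_of_bounded (h1.hasSum.mul_right (z.im ^ N)⁻¹) fun n => ?_⟩
  rw [norm_mul_addExp]
  rcases Nat.eq_zero_or_pos n with rfl | hn
  · simp only [ha, norm_zero, zero_mul]
    have := z.im_pos
    positivity
  have hn' : (0 : ℝ) < n := by exact_mod_cast hn
  have hz := z.im_pos
  have h2 : Real.exp (-(2 * Real.pi * n * z.im)) ≤ N ! * ((n : ℝ) ^ N)⁻¹ * (z.im ^ N)⁻¹ := by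
    have h3 := Real.pow_div_factorial_le_exp (x := n * z.im) (by positivity) N
    have h4 : Real.exp (n * z.im) ≤ Real.exp (2 * Real.pi * n * z.im) := by
      apply Real.exp_le_exp.2
      have : (1 : ℝ) ≤ 2 * Real.pi := by linarith [Real.pi_gt_three]
      calc n * z.im = 1 * (n * z.im) := (one_mul _).symm
        _ ≤ 2 * Real.pi * (n * z.im) := by gcongr
        _ = _ := by ring
    rw [Real.exp_neg]
    refine (inv_anti₀ (by positivity) (h3.trans h4)).trans (le_of_eq ?_)
    rw [inv_div, mul_pow, div_eq_mul_inv, mul_inv, mul_assoc]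
  have h5 : (n : ℝ) ^ σ * ((n : ℝ) ^ N)⁻¹ ≤ (n : ℝ) ^ (-2 : ℝ) := by
    rw [← Real.rpow_natCast, ← Real.rpow_neg hn'.le, ← Real.rpow_add hn']
    exact Real.rpow_le_rpow_of_exponent_le (by exact_mod_cast hn) (by linarith)
  calc ‖a n‖ * Real.exp (-(2 * Real.pi * n * z.im))
      ≤ C * (n : ℝ) ^ σ * (N ! * ((n : ℝ) ^ N)⁻¹ * (z.im ^ N)⁻¹) :=
        mul_le_mul (hC n hn.ne') h2 (Real.exp_nonneg _) (by positivity)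
    _ = C * N ! * ((n : ℝ) ^ σ * ((n : ℝ) ^ N)⁻¹) * (z.im ^ N)⁻¹ := by ring
    _ ≤ _ := by gcongr

end Growth

/-! ### The Fricke involution -/

section ImaginaryAxis

variable {a : ℕ → ℂ} {f : ℍ → ℂ} {r : ℝ}

lemma coe_expI_log {t : ℝ} (ht : 0 < t) : (expI (Real.log t) : ℂ) = t * Complex.I := by
  rw [coe_expI, Real.exp_log ht]

lemma im_expI_log {t : ℝ} (ht : 0 < t) : (expI (Real.log t)).im = t := by
  have h := congrArg Complex.im (coe_expI_log ht)
  rw [Complex.mul_I_im, Complex.ofReal_re] at h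
  exact h

lemma continuousOn_expI_log (hr : 0 < r) (hf : Continuous f) :
    ContinuousOn (fun t => f (expI (Real.log (t / r)))) (Set.Ioi 0) := by
  refine (hf.comp continuous_expI).comp_continuousOn (ContinuousOn.log (by fun_prop) fun t ht => ?_)
  exact (div_pos ht hr).ne'

lemma isBigO_expI_log_atTop (ha : a 0 = 0) (hr : 0 < r)
    (hf : ∀ z : ℍ, HasSum (fun n : ℕ => a n * addExp (n * z)) (f z)) :
    (fun t => f (expI (Real.log (t / r)))) =O[atTop] fun t => Real.exp (-(Real.pi / r) * t) := by
  obtain ⟨K, hK⟩ := exists_norm_le_exp ha hf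
  refine IsBigO.of_bound K ?_
  filter_upwards [eventually_ge_atTop r] with t ht
  have ht0 : 0 < t / r := div_pos (hr.trans_le ht) hr
  have h1 := hK (expI (Real.log (t / r)))
  rw [im_expI_log ht0] at h1
  rw [Real.norm_of_nonneg (Real.exp_nonneg _)]
  convert h1 ((one_le_div hr).2 ht) using 3
  ring

lemma isBigO_expI_log_zero {C σ : ℝ} (ha : a 0 = 0) (hr : 0 < r)
    (hf : ∀ z : ℍ, HasSum (fun n : ℕ => a n * addExp (n * z)) (f z))
    (hC : ∀ n : ℕ, n ≠ 0 → ‖a n‖ ≤ C * (n : ℝ) ^ σ) :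
    ∃ b : ℝ, (fun t => f (expI (Real.log (t / r)))) =O[𝓝[>] 0] (· ^ (-b)) := by
  obtain ⟨K, N, hK⟩ := exists_norm_le_inv_pow ha hf hC
  refine ⟨N, IsBigO.of_bound (K * r ^ N) ?_⟩
  filter_upwards [self_mem_nhdsWithin] with t ht
  have ht' : 0 < t := ht
  have h1 := hK (expI (Real.log (t / r)))
  rw [im_expI_log (div_pos ht' hr), div_pow, inv_div] at h1
  rw [Real.norm_of_nonneg (Real.rpow_nonneg ht'.le _), Real.rpow_neg ht'.le, Real.rpow_natCast]
  convert h1 using 1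
  ring

lemma mellin_expI_log {s l : ℂ} (ha : a 0 = 0) (hr : 0 < r)
    (hf : ∀ z : ℍ, HasSum (fun n : ℕ => a n * addExp (n * z)) (f z)) (hs : 0 < s.re)
    (hl : LSeriesHasSum a s l) :
    mellin (fun t => f (expI (Real.log (t / r)))) s =
      ((r / (2 * Real.pi) : ℝ) : ℂ) ^ s * Complex.Gamma s * l := by
  have hq : 0 < 2 * Real.pi / r := by positivity
  have hterm : ∀ n : ℕ, Complex.Gamma s * a n / (((2 * Real.pi / r) * n : ℝ) : ℂ) ^ s =
      ((r / (2 * Real.pi) : ℝ) : ℂ) ^ s * Complex.Gamma s * LSeries.term a s n := by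
    intro n
    rcases eq_or_ne n 0 with rfl | hn
    · simp [ha]
    rw [LSeries.term_of_ne_zero hn, Complex.ofReal_mul,
      Complex.mul_cpow_ofReal_nonneg hq.le (Nat.cast_nonneg n), Complex.ofReal_natCast,
      ← inv_div r, Complex.ofReal_inv, Complex.inv_cpow _ _ (by
        rw [Complex.arg_ofReal_of_nonneg (by positivity)]; exact Real.pi_pos.ne)]
    field_simp
  refine HasSum.unique (hasSum_mellin (a := a) (p := fun n => (2 * Real.pi / r) * n) ?_ hs ?_ ?_) ?_
  · intro n
    rcases Nat.eq_zero_or_pos n with rfl | hn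
    · exact Or.inl ha
    · exact Or.inr (by positivity)
  · intro t ht
    have ht' : 0 < t := ht
    convert hf (expI (Real.log (t / r))) using 3 with n
    rw [addExp, coe_expI_log (div_pos ht' hr), Complex.ofReal_exp]
    congr 1
    push_cast
    linear_combination (-(2 * Real.pi * n * t / r : ℂ)) * Complex.I_sq
  · have h1 := (hl.summable.norm).mul_left ((r / (2 * Real.pi)) ^ s.re)
    refine h1.congr fun n => ?_
    rcases eq_or_ne n 0 with rfl | hn
    · simp [ha]
    rw [LSeries.norm_term_eq, if_neg hn, Real.mul_rpow hq.le (Nat.cast_nonneg n), ← inv_div r,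
      Real.inv_rpow (by positivity)]
    field_simp
  · simp_rw [hterm]
    exact HasSum.mul_left _ hl

/-- Hecke's converse theorem for a single functional equation: `f` is an eigenfunction of the
Fricke involution. -/
theorem fricke_of_functional_equation {m N : ℕ} (hN : 0 < N) (ha : a 0 = 0)
    (hf_hol : MDifferentiable 𝓘(ℂ) 𝓘(ℂ) f)
    (hf : ∀ z : ℍ, HasSum (fun n : ℕ => a n * addExp (n * z)) (f z)) {C σ : ℝ}
    (hC : ∀ n : ℕ, n ≠ 0 → ‖a n‖ ≤ C * (n : ℝ) ^ σ) {c : ℝ} {L Λ : ℂ → ℂ}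
    (hL : ∀ s : ℂ, c < s.re → LSeriesHasSum a s (L s))
    (hΛ : ∀ s : ℂ, c < s.re →
      Λ s = ((Real.sqrt N / (2 * Real.pi) : ℝ) : ℂ) ^ s * Complex.Gamma s * L s)
    (hΛ_entire : Differentiable ℂ Λ) (hΛ_bdd : BoundedInVerticalStrips Λ) {ε : ℂ}
    (hε : ε * ε = 1) (hFE : ∀ s : ℂ, Λ s = ε * Λ ((2 * m : ℕ) - s)) :
    normSlash m f 0 (-1) N 0 = ((-1) ^ m * ε) • f := by
  have hNR : (0 : ℝ) < N := by exact_mod_cast hN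
  have hr : 0 < √(N : ℝ) := Real.sqrt_pos.2 hNR
  obtain ⟨b, hb⟩ := isBigO_expI_log_zero ha hr hf hC
  have hinv := fun {t : ℝ} => inversion_of_mellin_functional_equation (t := t)
    (continuousOn_expI_log hr hf_hol.continuous) (div_pos Real.pi_pos hr)
    (isBigO_expI_log_atTop ha hr hf) hb hΛ_entire hΛ_bdd (c := max c 0) (fun s hs => by
      rw [hΛ s ((le_max_left _ _).trans_lt hs), mellin_expI_log ha hr hf
        ((le_max_right _ _).trans_lt hs) (hL s ((le_max_left _ _).trans_lt hs))]) hε hFE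
  have hdet : (0 : ℝ) < 0 * 0 - (-1) * N := by linarith
  -- The bound -log √N is the condition t = √N·eˣ < 1. On this part of the axis W is t ↦ 1/t, and
  -- the automorphy factor is (-1)ᵐt⁻²ᵐ.
  refine eq_of_eq_imaginary_axis (hf_hol.normSlash hdet) (hf_hol.const_smul _)
    (x₀ := -Real.log √(N : ℝ)) fun x hx => ?_
  set t : ℝ := √(N : ℝ) * Real.exp x with ht
  have ht0 : 0 < t := by positivity
  have hx1 : Real.log (t / √(N : ℝ)) = x := by
    rw [ht, mul_div_cancel_left₀ _ hr.ne', Real.log_exp]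
  have ht1 : t < 1 := by
    rw [← Real.log_neg_iff ht0, ht, Real.log_mul hr.ne' (Real.exp_pos x).ne', Real.log_exp]
    linarith
  have hW : realGL 0 (-1) N 0 • expI x = expI (Real.log (t⁻¹ / √(N : ℝ))) := by
    apply UpperHalfPlane.ext
    rw [coe_realGL_smul hdet, coe_expI_log (by positivity), coe_expI]
    have h1 : t⁻¹ / √(N : ℝ) = (N * Real.exp x)⁻¹ := by
      rw [ht, div_eq_mul_inv, ← mul_inv, mul_right_comm, Real.mul_self_sqrt hNR.le]
    have h2 : (Real.exp x : ℂ) ≠ 0 := by exact_mod_cast (Real.exp_pos x).ne'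
    have h3 : (N : ℂ) ≠ 0 := by exact_mod_cast hN.ne'
    rw [h1]
    push_cast
    push_cast at h2
    field_simp
    linear_combination (-(Complex.exp x * N)) * Complex.I_sq
  have key := hinv ht0 ht1
  rw [hx1, ← hW] at key
  rw [normSlash, Pi.smul_apply, key, smul_eq_mul]
  have h4 : (t : ℂ) ^ (-((2 * m : ℕ) : ℂ)) = ((t : ℂ) ^ (2 * m))⁻¹ := by
    rw [Complex.cpow_neg, Complex.cpow_natCast]
  have h5 : ((0 * 0 - -1 * N : ℝ) : ℂ) / ((N : ℝ) * (expI x : ℂ) + (0 : ℝ)) ^ 2 =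
      -1 * ((t : ℂ) ^ 2)⁻¹ := by
    have h6 : (t : ℂ) ^ 2 = N * (Real.exp x : ℂ) ^ 2 := by
      rw [ht, ← Complex.ofReal_pow, mul_pow, Real.sq_sqrt hNR.le]
      push_cast
      ring
    have h2 : (Real.exp x : ℂ) ≠ 0 := by exact_mod_cast (Real.exp_pos x).ne'
    have h3 : (N : ℂ) ≠ 0 := by exact_mod_cast hN.ne'
    rw [h6, coe_expI, Complex.ofReal_zero, add_zero, mul_pow, mul_pow, Complex.I_sq]
    push_cast
    push_cast at h2
    field_simp
    ring
  rw [h4, h5, mul_pow, inv_pow, ← pow_mul]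
  linear_combination (-(-1 : ℂ) ^ m * ((t : ℂ) ^ (2 * m))⁻¹ * f (realGL 0 (-1) N 0 • expI x)) * hε

end ImaginaryAxis

end

/-! ### Assembly of the theorem -/

lemma HasDirichletSum.congr {a b : ℕ → ℂ} {s l : ℂ} (h : HasDirichletSum a s l)
    (hab : ∀ n, n ≠ 0 → a n = b n) : HasDirichletSum b s l := by
  refine Filter.Tendsto.congr (fun N => Finset.sum_congr rfl fun n hn => ?_) h
  rw [hab n (Nat.one_le_iff_ne_zero.1 (Finset.mem_Icc.1 hn).1)]

/-- Convergence at some σ with c < σ < Re s - 1 bounds the coefficients by a multiple of n^σ, which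
gives absolute convergence at s. -/
lemma HasDirichletSum.lseriesHasSum_of_lt {a : ℕ → ℂ} {c : ℝ} {L : ℂ → ℂ}
    (h : ∀ s : ℂ, c < s.re → HasDirichletSum a s (L s)) {s : ℂ} (hs : c + 2 < s.re) :
    LSeriesHasSum a s (L s) := by
  obtain ⟨σ, hσ, hσs⟩ := exists_between (show c < s.re - 1 by linarith)
  obtain ⟨C, hC⟩ := (h (σ : ℂ) (by simpa using hσ)).exists_norm_le
  refine (h s (by linarith)).lseriesHasSum
    (LSeriesSummable_of_le_const_mul_rpow (x := σ + 1) (by linarith) ⟨C, fun n hn => ?_⟩)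
  rw [add_sub_cancel_right]
  exact hC n hn

theorem theorem1
    (k : ℕ) (hk : 0 < k) (hk_even : Even k)
    -- the Fourier series `f`, holomorphic on the upper half-plane
    (a : ℕ → ℂ) (f : ℍ → ℂ)
    (hf : ∀ z : ℍ,
      HasSum (fun n : ℕ+ => a n * Complex.exp (2 * Real.pi * Complex.I * (n * (z : ℂ)))) (f z))
    (hf_hol : MDifferentiable 𝓘(ℂ) 𝓘(ℂ) f)
    -- the Dirichlet series `L` converges for `Re s > c`
    (c : ℝ) (L : ℂ → ℂ)
    (hL : ∀ s : ℂ, c < s.re → HasDirichletSum a s (L s))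
    -- the Euler factors at 2 and 3, with `M` the Dirichlet series over the `n` coprime to 6
    (M : ℂ → ℂ)
    (hM : ∀ s : ℂ, c < s.re → HasDirichletSum (fun n => if n.Coprime 6 then a n else 0) s (M s))
    (hEuler : ∀ s : ℂ, c < s.re →
      L s = (1 - a 2 / (2 : ℂ) ^ s + (2 : ℂ) ^ (k - 1) / (2 : ℂ) ^ (2 * s))⁻¹
        * (1 - a 3 / (3 : ℂ) ^ s + (3 : ℂ) ^ (k - 1) / (3 : ℂ) ^ (2 * s))⁻¹ * M s)
    -- the completed function `Λ`, continued to an entire function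
    (Λ : ℂ → ℂ)
    (hΛ : ∀ s : ℂ, c < s.re →
      Λ s = ((Real.sqrt 13 / (2 * Real.pi) : ℝ) : ℂ) ^ s * Complex.Gamma s * L s)
    (hΛ_entire : Differentiable ℂ Λ)
    (hΛ_bdd : BoundedInVerticalStrips Λ)
    (ε : ℂ) (hε : ε = 1 ∨ ε = -1)
    (hFE : ∀ s : ℂ, Λ s = ε * Λ (k - s)) :
    ∃ g : CuspForm (CongruenceSubgroup.Gamma0 13 : Subgroup (GL (Fin 2) ℝ)) (k : ℤ),
      (g : ℍ → ℂ) = f := by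
  obtain ⟨m, rfl⟩ := hk_even.two_dvd
  have hm : 0 < m := by omega
  have hε2 : ε * ε = 1 := by rcases hε with rfl | rfl <;> norm_num
  -- normalise the irrelevant value `a 0`
  set a' : ℕ → ℂ := fun n => if n = 0 then 0 else a n with ha'
  have ha0 : a' 0 = 0 := if_pos rfl
  have haa : ∀ n, n ≠ 0 → a n = a' n := fun n hn => (if_neg hn).symm
  have hf' := fourier_hasSum_nat ha0 (f := f) fun z => by
    simpa only [← haa _ (PNat.ne_zero _)] using hf z
  have hL' : ∀ s : ℂ, c < s.re → HasDirichletSum a' s (L s) := fun s hs => (hL s hs).congr haa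
  have hLs : ∀ s : ℂ, c + 2 < s.re → LSeriesHasSum a' s (L s) := fun s hs =>
    HasDirichletSum.lseriesHasSum_of_lt hL' hs
  have hMs : ∀ s : ℂ, c + 2 < s.re →
      LSeriesHasSum (fun n => if n.Coprime 6 then a n else 0) s (M s) := fun s hs =>
    HasDirichletSum.lseriesHasSum_of_lt hM hs
  have hvanish : ∀ p, p ∣ 6 → 1 < p → ∀ n : ℕ, n ≠ 0 → p ∣ n →
      (if n.Coprime 6 then a n else 0) = 0 := fun p hp6 hp n _ hpn =>
    if_neg fun h => hp.ne' (Nat.eq_one_of_dvd_coprimes h hpn hp6)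
  -- Hecke relations at 2 and 3
  have hrel2 : ∀ n, n ≠ 0 → a' (2 * n) = a 2 * a' n - ((2 : ℕ) : ℂ) ^ (2 * m - 1) * dilate 2 a' n :=
    hecke_coefficients (q := 3) (by norm_num) (by norm_num) (by norm_num) hLs hMs (α' := a 3)
      (β' := (3 : ℂ) ^ (2 * m - 1))
      (fun s hs => by rw [hEuler s (by linarith)]; norm_num)
      (hvanish 2 (by norm_num) (by norm_num))
  have hrel3 : ∀ n, n ≠ 0 → a' (3 * n) = a 3 * a' n - ((3 : ℕ) : ℂ) ^ (2 * m - 1) * dilate 3 a' n :=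
    hecke_coefficients (q := 2) (by norm_num) (by norm_num) (by norm_num) hLs hMs (α' := a 2)
      (β' := (2 : ℂ) ^ (2 * m - 1))
      (fun s hs => by rw [hEuler s (by linarith), mul_comm (_⁻¹) (_⁻¹)]; norm_num)
      (hvanish 3 (by norm_num) (by norm_num))
  have h2 := normSlash_hecke hm (by norm_num) ha0 hf' hrel2
  have h3 := normSlash_hecke hm (by norm_num) ha0 hf' hrel3
  simp only [Finset.sum_range_succ, Finset.sum_range_zero, zero_add, Nat.cast_zero, Nat.cast_one,
    Nat.cast_ofNat, ← add_assoc] at h2 h3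
  -- the Fricke involution
  obtain ⟨C, hC⟩ := (hL' ((c + 1 : ℝ) : ℂ) (by simp)).exists_norm_le
  have hW : normSlash m f 0 (-1) 13 0 = ((-1) ^ m * ε) • f := by
    have := fricke_of_functional_equation (N := 13) (by norm_num) ha0 hf_hol hf' hC hLs
      (fun s hs => by simpa using hΛ s (by linarith)) hΛ_entire hΛ_bdd hε2 hFE
    simpa only [Nat.cast_ofNat] using this
  have he : ((-1) ^ m * ε) * ((-1) ^ m * ε) = 1 := by
    rw [mul_mul_mul_comm, hε2, mul_one, ← mul_pow]; norm_num
  have hT := normSlash_translate (m := m) hf'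
  have hΓ : ∀ a b c d : ℤ, a * d - b * (13 * c) = 1 →
      normSlash m f a b ((13 * c : ℤ) : ℝ) d = f := fun a b c d h =>
    gamma0_thirteen_invariant hT (exists_invariant_of_hecke hm hf_hol he hT hW h2 h3) _ a b c d rfl h
  exact_mod_cast exists_cuspForm_gamma0_thirteen hf_hol (isZeroAtImInfty_of_hasSum ha0 hf') hW hΓ
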